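/- **Theorem 2.** Fix constants $\sigma>0$ and $\varepsilon_0>0$. For a set $\Omega\subset\mathbb R^3$ let $|\Omega|$ be its Lebesgue measure, let $$P(\Omega)=\sup\Big\{\int_\Omega \nabla\cdot F\,dx:\ F\in C^1_c(\mathbb R^3;\mathbb R^3),\ |F|\le 1\Big\}$$ be its perimeter, let $$C^{-1}(\Omega)=\inf_{\mu(\Omega)=1}\int_\Omega\int_\Omega\frac{1}{4\pi\varepsilon_0|x-y|}\,d\mu(x)\,d\mu(y)$$ be its inverse capacitance, the infimum being over nonnegative Borel measures $\mu$ carried by $\Omega$ with $\mu(\Omega)=1$, and for $Q>0$ let $$E(\Omega)=\sigma P(\Omega)+\frac{Q^2}{2C(\Omega)}.$$ Let $V>0$ and $Q>0$, let $R>0$ be such that $V=\frac43\pi R^3$, and let $B_R$ be the closed ball of radius $R$ centered at the origin. (i) There are $\nu_0\in\mathbb S^2$ and $\delta_0>0$ such that for every $\delta\in(0,\delta_0)$ there is a smooth function $\phi_\delta:\mathbb S^2\to(-\delta,\delta)$, whose support is contained in the open geodesic ball of radius $\delta/R$ centered at $\nu_0$ on $\mathbb S^2$, such that the set $$\Omega_{R,\delta}=\{0\}\cup\{x\in\mathbb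 R^3\setminus\{0\}:\ |x|\le R+\phi_\delta(x/|x|)\}$$ satisfies $|\Omega_{R,\delta}|=V$ and $E(\Omega_{R,\delta})<E(B_R)$. (ii) Consequently, the ball $B_R$ is not a local minimizer of $E$ at volume $V$, even among smooth sets homeomorphic to the ball that are close to it in Hausdorff distance: for every $\epsilon>0$ there is a compact set $\Omega\subset\mathbb R^3$ with smooth boundary, homeomorphic to $B_R$, with $|\Omega|=V$, with Hausdorff distance to $B_R$ less than $\epsilon$, and with $E(\Omega)<E(B_R)$. -/

import Mathlib

open MeasureTheory
open scoped ENNReal Manifold ContDiff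

noncomputable section

namespace ConductingDrop

/-- Euclidean three-space. -/
abbrev E3 : Type := EuclideanSpace ℝ (Fin 3)

/-- The unit sphere `S²` of `ℝ³`, with Mathlib's smooth manifold structure. -/
abbrev S2 : Type := Metric.sphere (0 : E3) 1

/-- The divergence `∑ i, ∂ᵢ Fᵢ` of a vector field on `ℝ³`. -/
def divergence (F : E3 → E3) (x : E3) : ℝ :=
  ∑ i : Fin 3, (fderiv ℝ F x (EuclideanSpace.single i 1)) i

/-- De Giorgi's perimeter of `Ω`: the supremum of `∫_Ω div F` over all compactly supported `C¹`
vector fields `F` with `|F| ≤ 1`. Since `F = 0` competes, truncating at `0` is harmless. -/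
def perimeter (Ω : Set E3) : ℝ≥0∞ :=
  ⨆ (F : E3 → E3) (_ : ContDiff ℝ 1 F) (_ : HasCompactSupport F) (_ : ∀ x, ‖F x‖ ≤ 1),
    ENNReal.ofReal (∫ x in Ω, divergence F x)

/-- The Coulomb kernel `1 / (4 π ε₀ |x - y|)`, equal to `∞` on the diagonal when `ε₀ > 0`. -/
def coulombKernel (ε₀ : ℝ) (x y : E3) : ℝ≥0∞ :=
  (ENNReal.ofReal (4 * Real.pi * ε₀ * dist x y))⁻¹

/-- `C⁻¹(Ω)`: the infimum of the Coulomb energy over all nonnegative Borel measures `μ` that are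
carried by `Ω` and have `μ(Ω) = 1`. -/
def inverseCapacitance (ε₀ : ℝ) (Ω : Set E3) : ℝ≥0∞ :=
  ⨅ (μ : Measure E3) (_ : μ Ω = 1) (_ : μ Ωᶜ = 0),
    ∫⁻ x in Ω, ∫⁻ y in Ω, coulombKernel ε₀ x y ∂μ ∂μ

/-- The electrical capacitance `C(Ω)`. -/
def capacitance (ε₀ : ℝ) (Ω : Set E3) : ℝ≥0∞ :=
  (inverseCapacitance ε₀ Ω)⁻¹

/-- The energy `E(Ω) = σ P(Ω) + Q² / (2 C(Ω))` of a conducting drop `Ω` of charge `Q`. -/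
def energy (σ ε₀ Q : ℝ) (Ω : Set E3) : ℝ≥0∞ :=
  ENNReal.ofReal σ * perimeter Ω + ENNReal.ofReal (Q ^ 2) / (2 * capacitance ε₀ Ω)

/-- The direction `x / |x| ∈ S²` of a nonzero vector. -/
def direction (x : E3) (hx : x ≠ 0) : S2 :=
  ⟨‖x‖⁻¹ • x, by
    rw [mem_sphere_zero_iff_norm, norm_smul, norm_inv, norm_norm,
      inv_mul_cancel₀ (norm_ne_zero_iff.mpr hx)]⟩

/-- The set `{x : |x| ≤ R + φ (x / |x|)}`; the origin, where the direction is undefined, belongs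
to it. -/
def starSet (R : ℝ) (φ : S2 → ℝ) : Set E3 :=
  {x | ∀ hx : x ≠ 0, ‖x‖ ≤ R + φ (direction x hx)}

/-- The open ball of radius `ρ` around `ν₀` on `S²`, in the geodesic (angular) distance. -/
def sphericalCap (ν₀ : S2) (ρ : ℝ) : Set S2 :=
  {ν | InnerProductGeometry.angle (ν : E3) (ν₀ : E3) < ρ}

/-- `Ω` has smooth boundary: near each boundary point it is a sublevel set of a smooth function
with nonvanishing differential there. -/
def HasSmoothBoundary (Ω : Set E3) : Prop :=
  ∀ x ∈ frontier Ω, ∃ (U : Set E3) (F : E3 → ℝ), IsOpen U ∧ x ∈ U ∧ ContDiffOn ℝ ∞ F U ∧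
    fderiv ℝ F x ≠ 0 ∧ Ω ∩ U = {y | F y ≤ 0} ∩ U

end ConductingDrop

end

/-! The ball loses against a ball that carries a thin spike. Fix the height `A` of the spike and let
its width `r` tend to `0`. The spike has slope of order `A / r` over a cap of area of order `r ^ 2`,
so it costs at most `C₁ * r` in perimeter. Its volume is of order `r ^ 2` and is removed by a dent
of fixed width and depth `t ≤ C * r ^ 2`; this changes the perimeter and the potential only at order
`r ^ 2`.

Electrostatics gains more. In units where the kernel is `1 / |x - y|`, move a charge `q` from the
sphere of radius `R - t` to `n` spheres of radius `r * R / 4` strung along the spike, all centred at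
distance at least `D > R` from the origin. To first order this saves `2 * q * (1 / R - 1 / D)`, and
the self-energy of the small spheres costs `4 * q ^ 2 / (n * r * R)`. The best `q` is proportional
to `n * r`, and the net gain is then a constant times `n * r`. Choose `n` so large that this beats
the perimeter cost, and only then `r` so small that the remaining terms, of order `r ^ 2` for fixed
`n` (mutual repulsion of the small spheres, dent), are negligible.

Only upper bounds for the spike and lower bounds for the ball are needed. For the spike:
`perimeter_starSet_le`, by smoothing the indicator function, and `inverseCapacitance_le_of_spheres`,
by the shell theorem. For the ball: `le_perimeter_closedBall`, by testing with an extension of the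
normal field, and `le_inverseCapacitance_closedBall`, by positive definiteness of the Newtonian
kernel, which is a multiple of the inverse-square kernel composed with itself. The two sides meet in
`exists_charge_transfer` and `exists_spike_energy_lt`. -/

noncomputable section

namespace ConductingDrop

open Set Filter Topology

/-! ### Spherical coordinates and Archimedes' hat-box theorem. -/

/-- The surface measure of the unit sphere. -/
def surf : Measure S2 := (volume : Measure E3).toSphere

instance : IsFiniteMeasure surf := by unfold surf; infer_instance

theorem lintegral_volumeIoiPow (n : ℕ) (g : ℝ → ℝ≥0∞) (hg : Measurable g) :
    ∫⁻ r, g r ∂(Measure.volumeIoiPow n) = ∫⁻ s in Ioi (0 : ℝ), ENNReal.ofReal (s ^ n) * g s := by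
  rw [Measure.volumeIoiPow, lintegral_withDensity_eq_lintegral_mul _ (by fun_prop) (by fun_prop)]
  exact lintegral_subtype_comap measurableSet_Ioi (fun s : ℝ => ENNReal.ofReal (s ^ n) * g s)

/-- Integration in spherical coordinates. -/
theorem lintegral_polar {f : E3 → ℝ≥0∞} (hf : Measurable f) :
    ∫⁻ x, f x =
      ∫⁻ ν : S2, ∫⁻ s in Ioi (0 : ℝ), ENNReal.ofReal (s ^ 2) * f (s • (ν : E3)) ∂volume ∂surf := by
  have h0 : ∫⁻ x, f x = ∫⁻ x in ({0}ᶜ : Set E3), f x := by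
    rw [restrict_compl_singleton]
  have h1 := (volume : Measure E3).measurePreserving_homeomorphUnitSphereProd
  rw [h0, ← lintegral_subtype_comap (measurableSet_singleton _).compl]
  have h2 := h1.lintegral_comp_emb (Homeomorph.measurableEmbedding _)
    (fun p => f ((p.2 : ℝ) • (p.1 : E3)))
  have h3 : ∀ x : ({0}ᶜ : Set E3), f ((((homeomorphUnitSphereProd E3 x).2 : ℝ)) •
      ((homeomorphUnitSphereProd E3 x).1 : E3)) = f x := by
    intro x
    exact congrArg f (congrArg Subtype.val ((homeomorphUnitSphereProd E3).symm_apply_apply x))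
  simp only [h3] at h2
  rw [h2, lintegral_prod _ (by fun_prop)]
  refine lintegral_congr fun ν => ?_
  have : Module.finrank ℝ E3 - 1 = 2 := by simp
  rw [this]
  exact lintegral_volumeIoiPow 2 (fun s => f (s • (ν : E3))) (by fun_prop)

theorem lintegral_volume_eq {f : E3 → ℝ≥0∞} (hf : Measurable f) :
    ∫⁻ x, f x = ∫⁻ z : ℝ, ∫⁻ p : ℝ × ℝ, f (!₂[z, p.1, p.2]) := by
  rw [← (PiLp.volume_preserving_toLp (Fin 3)).lintegral_comp hf]
  have h1 := (volume_preserving_piFinSuccAbove (fun _ : Fin 3 => ℝ) 0).symm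
  rw [← h1.lintegral_comp (by fun_prop)]
  have h2 := ((MeasurePreserving.id (volume : Measure ℝ)).prod
    (volume_preserving_finTwoArrow ℝ).symm)
  have hm : Measurable fun a : ℝ × (Fin 2 → ℝ) => f (WithLp.toLp 2
      ((MeasurableEquiv.piFinSuccAbove (fun _ : Fin 3 => ℝ) 0).symm a)) := by fun_prop
  have h3 := h2.lintegral_comp hm
  refine h3.symm.trans ?_
  rw [lintegral_prod _ (by fun_prop)]
  refine lintegral_congr fun z => lintegral_congr fun p => ?_
  congr 2
  ext i
  fin_cases i <;> rfl

/-- Integration of axially symmetric functions. -/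
theorem lintegral_axial {H : ℝ × ℝ → ℝ≥0∞} (hH : Measurable H) :
    ∫⁻ x : E3, H (x 0, √(x 1 ^ 2 + x 2 ^ 2)) =
      ENNReal.ofReal (2 * Real.pi) * ∫⁻ ρ in Ioi (0 : ℝ), ∫⁻ θ in Ioo 0 Real.pi,
        ENNReal.ofReal (ρ ^ 2) * (ENNReal.ofReal (Real.sin θ) *
          H (ρ * Real.cos θ, ρ * Real.sin θ)) := by
  rw [lintegral_volume_eq (by fun_prop)]
  have h1 : ∀ z : ℝ, ∫⁻ p : ℝ × ℝ, H (z, √(p.1 ^ 2 + p.2 ^ 2)) =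
      ENNReal.ofReal (2 * Real.pi) * ∫⁻ s in Ioi (0 : ℝ), ENNReal.ofReal s * H (z, s) := by
    intro z
    rw [← lintegral_comp_polarCoord_symm]
    simp only [polarCoord_target, polarCoord_symm_apply]
    rw [Measure.volume_eq_prod, ← Measure.prod_restrict, lintegral_prod _ (by fun_prop),
      ← lintegral_const_mul _ (by fun_prop)]
    refine setLIntegral_congr_fun measurableSet_Ioi fun s hs => ?_
    have hs' : (0 : ℝ) < s := hs
    have : ∀ θ : ℝ, √((s * Real.cos θ) ^ 2 + (s * Real.sin θ) ^ 2) = s := by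
      intro θ
      rw [show (s * Real.cos θ) ^ 2 + (s * Real.sin θ) ^ 2 =
        s ^ 2 * (Real.sin θ ^ 2 + Real.cos θ ^ 2) by ring, Real.sin_sq_add_cos_sq, mul_one,
        Real.sqrt_sq hs'.le]
    simp only [this, smul_eq_mul, lintegral_const, Measure.restrict_apply_univ, Real.volume_Ioo]
    rw [mul_comm]; congr 2; ring
  have h2 : ∀ z : ℝ, ∫⁻ p : ℝ × ℝ, H ((!₂[z, p.1, p.2] : E3) 0,
      √((!₂[z, p.1, p.2] : E3) 1 ^ 2 + (!₂[z, p.1, p.2] : E3) 2 ^ 2)) =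
      ENNReal.ofReal (2 * Real.pi) * ∫⁻ s in Ioi (0 : ℝ), ENNReal.ofReal s * H (z, s) :=
    fun z => h1 z
  simp only [h2]
  rw [lintegral_const_mul _ (by fun_prop)]
  congr 1
  -- Extension by zero from the half-plane `s > 0` to the whole plane lets polar coordinates apply a
  -- second time, now in `(z, s)`; the half-plane becomes `0 < θ < π`.
  have h3 : ∫⁻ z : ℝ, ∫⁻ s in Ioi (0 : ℝ), ENNReal.ofReal s * H (z, s) =
      ∫⁻ p : ℝ × ℝ, (Ioi (0 : ℝ)).indicator (fun s => ENNReal.ofReal s * H (p.1, s)) p.2 := by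
    have hm : Measurable fun p : ℝ × ℝ =>
        (Ioi (0 : ℝ)).indicator (fun s => ENNReal.ofReal s * H (p.1, s)) p.2 := by
      have : (fun p : ℝ × ℝ =>
        (Ioi (0 : ℝ)).indicator (fun s => ENNReal.ofReal s * H (p.1, s)) p.2) =
        (Prod.snd ⁻¹' Ioi (0 : ℝ)).indicator (fun p => ENNReal.ofReal p.2 * H p) := by
        ext p; simp [indicator]
      rw [this]
      exact Measurable.indicator (by fun_prop) (measurable_snd measurableSet_Ioi)
    rw [Measure.volume_eq_prod, lintegral_prod _ hm.aemeasurable]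
    refine lintegral_congr fun z => ?_
    exact (lintegral_indicator measurableSet_Ioi _).symm
  rw [h3, ← lintegral_comp_polarCoord_symm]
  simp only [polarCoord_target, polarCoord_symm_apply]
  have hm : Measurable fun p : ℝ × ℝ => ENNReal.ofReal p.1 • (Ioi (0 : ℝ)).indicator
      (fun s => ENNReal.ofReal s * H (p.1 * Real.cos p.2, s)) (p.1 * Real.sin p.2) := by
    have : (fun p : ℝ × ℝ => (Ioi (0 : ℝ)).indicator
      (fun s => ENNReal.ofReal s * H (p.1 * Real.cos p.2, s)) (p.1 * Real.sin p.2)) =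
      ((fun p : ℝ × ℝ => p.1 * Real.sin p.2) ⁻¹' Ioi (0 : ℝ)).indicator
        (fun p => ENNReal.ofReal (p.1 * Real.sin p.2) *
          H (p.1 * Real.cos p.2, p.1 * Real.sin p.2)) := by
      ext p; simp [indicator]
    have h4 : Measurable fun p : ℝ × ℝ => p.1 * Real.sin p.2 := by fun_prop
    refine Measurable.smul (f := fun p : ℝ × ℝ => ENNReal.ofReal p.1) (by fun_prop) ?_
    rw [this]
    exact Measurable.indicator (by fun_prop) (h4 measurableSet_Ioi)
  rw [Measure.volume_eq_prod, ← Measure.prod_restrict, lintegral_prod _ hm.aemeasurable]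
  refine setLIntegral_congr_fun measurableSet_Ioi fun ρ hρ => ?_
  have hρ' : (0 : ℝ) < ρ := hρ
  dsimp only
  rw [← lintegral_indicator measurableSet_Ioo, ← lintegral_indicator measurableSet_Ioo]
  refine lintegral_congr fun θ => ?_
  by_cases h0 : θ ∈ Ioo 0 Real.pi
  · have hs := Real.sin_pos_of_mem_Ioo h0
    have : θ ∈ Ioo (-Real.pi) Real.pi := ⟨by linarith [h0.1, Real.pi_pos], h0.2⟩
    simp only [indicator_of_mem h0, indicator_of_mem this]
    rw [indicator_of_mem (mem_Ioi.2 (by positivity)), smul_eq_mul, ENNReal.ofReal_mul hρ'.le, pow_two,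
      ENNReal.ofReal_mul hρ'.le]
    ring
  · rw [indicator_of_notMem h0]
    by_cases h1 : θ ∈ Ioo (-Real.pi) Real.pi
    · rw [indicator_of_mem h1, indicator_of_notMem, smul_zero]
      have : Real.sin θ ≤ 0 := by
        apply Real.sin_nonpos_of_nonpos_of_neg_pi_le _ h1.1.le
        by_contra h; exact h0 ⟨not_le.1 h, h1.2⟩
      simp only [mem_Ioi, not_lt]
      exact mul_nonpos_of_nonneg_of_nonpos hρ'.le this
    · rw [indicator_of_notMem h1]

theorem lintegral_sin_cos (f : ℝ → ℝ≥0∞) :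
    ∫⁻ θ in Ioo 0 Real.pi, ENNReal.ofReal (Real.sin θ) * f (Real.cos θ) =
      ∫⁻ t in Ioo (-1 : ℝ) 1, f t := by
  have himg : Real.cos '' Ioo 0 Real.pi = Ioo (-1) 1 := by
    ext t
    constructor
    · rintro ⟨θ, hθ, rfl⟩
      have := Real.strictAntiOn_cos (left_mem_Icc.2 Real.pi_pos.le) (Ioo_subset_Icc_self hθ) hθ.1
      have := Real.strictAntiOn_cos (Ioo_subset_Icc_self hθ) (right_mem_Icc.2 Real.pi_pos.le) hθ.2
      simp_all
    · intro ht
      refine ⟨Real.arccos t, ⟨Real.arccos_pos.2 ht.2, Real.arccos_lt_pi.2 ht.1⟩,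
        Real.cos_arccos ht.1.le ht.2.le⟩
  rw [← himg, lintegral_image_eq_lintegral_abs_deriv_mul measurableSet_Ioo
    (fun θ _ => (Real.hasDerivAt_cos θ).hasDerivWithinAt)
    (Real.injOn_cos.mono Ioo_subset_Icc_self)]
  refine setLIntegral_congr_fun measurableSet_Ioo fun θ hθ => ?_
  rw [abs_neg, abs_of_pos (Real.sin_pos_of_mem_Ioo hθ)]

/-- The bridge between the sphere and Lebesgue measure: a function constant on rays has a ball
integral that factors, so symmetries and coordinates of `ℝ³` yield identities for `surf` once the
radial factor, neither `0` nor `∞`, is cancelled. -/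
theorem lintegral_ball_homogeneous {f : E3 → ℝ≥0∞} (hf : Measurable f)
    (hom : ∀ s : ℝ, 0 < s → ∀ x, f (s • x) = f x) :
    ∫⁻ x in Metric.ball (0 : E3) 1, f x =
      (∫⁻ s in Ioo (0 : ℝ) 1, ENNReal.ofReal (s ^ 2)) * ∫⁻ ν : S2, f ν ∂surf := by
  rw [← lintegral_indicator Metric.isOpen_ball.measurableSet,
    lintegral_polar (hf.indicator Metric.isOpen_ball.measurableSet), mul_comm,
    ← lintegral_mul_const _ (by fun_prop)]
  refine lintegral_congr fun ν => ?_
  rw [← lintegral_indicator measurableSet_Ioo, ← lintegral_const_mul _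
    (Measurable.indicator (by fun_prop) measurableSet_Ioo), ← lintegral_indicator measurableSet_Ioi]
  refine lintegral_congr fun s => ?_
  by_cases h0 : 0 < s
  · rw [indicator_of_mem (mem_Ioi.2 h0)]
    have : ‖s • (ν : E3)‖ = s := by simp [norm_smul, abs_of_pos h0]
    by_cases h1 : s < 1
    · rw [indicator_of_mem (by simpa [this] using h1), indicator_of_mem (mem_Ioo.2 ⟨h0, h1⟩), hom s h0, mul_comm]
    · rw [indicator_of_notMem (by simpa [this] using h1), indicator_of_notMem (fun h => h1 h.2)]
      simp
  · rw [indicator_of_notMem (by simpa using h0), indicator_of_notMem (fun h => h0 h.1), mul_zero]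

theorem radial_weight_ne_zero : ∫⁻ s in Ioo (0 : ℝ) 1, ENNReal.ofReal (s ^ 2) ≠ 0 := by
  rw [← pos_iff_ne_zero, setLIntegral_pos_iff (by fun_prop)]
  have : Function.support (fun s : ℝ => ENNReal.ofReal (s ^ 2)) ∩ Ioo 0 1 = Ioo 0 1 := by
    rw [inter_eq_right]
    intro s hs
    simp [hs.1.ne']
  rw [this]; simp

theorem radial_weight_ne_top : ∫⁻ s in Ioo (0 : ℝ) 1, ENNReal.ofReal (s ^ 2) ≠ ⊤ := by
  refine ne_top_of_le_ne_top (b := ∫⁻ s in Ioo (0 : ℝ) 1, 1) (by simp) ?_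
  refine setLIntegral_mono measurable_const fun s hs => ?_
  rw [← ENNReal.ofReal_one]
  exact ENNReal.ofReal_le_ofReal (pow_le_one₀ hs.1.le hs.2.le)

/-- Archimedes' hat-box theorem, for the first coordinate. -/
theorem lintegral_surf_coord {f : ℝ → ℝ≥0∞} (hf : Measurable f) :
    ∫⁻ ν : S2, f ((ν : E3) 0) ∂surf =
      ENNReal.ofReal (2 * Real.pi) * ∫⁻ t in Ioo (-1 : ℝ) 1, f t := by
  -- The integral of the degree-zero extension over the unit ball is computed in two ways, by rays
  -- and by axial coordinates.
  have h1 := lintegral_ball_homogeneous (f := fun x => f (x 0 / ‖x‖)) (by fun_prop) (by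
    intro s hs x
    congr 1
    simp only [PiLp.smul_apply, smul_eq_mul, norm_smul, Real.norm_eq_abs, abs_of_pos hs]
    rw [mul_div_mul_left _ _ hs.ne'])
  have hn : ∀ x : E3, ‖x‖ = √(x 0 ^ 2 + √(x 1 ^ 2 + x 2 ^ 2) ^ 2) := by
    intro x
    rw [EuclideanSpace.norm_eq, Fin.sum_univ_three, Real.sq_sqrt (by positivity)]
    simp [add_assoc]
  set H : ℝ × ℝ → ℝ≥0∞ := fun p => {p : ℝ × ℝ | √(p.1 ^ 2 + p.2 ^ 2) < 1}.indicator
    (fun p => f (p.1 / √(p.1 ^ 2 + p.2 ^ 2))) p with hHdef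
  have hH : Measurable H := by
    refine Measurable.indicator (by fun_prop) (measurableSet_lt (by fun_prop) (by fun_prop))
  have h2 := lintegral_axial hH
  have h3 : ∫⁻ x in Metric.ball (0 : E3) 1, f (x 0 / ‖x‖) =
      ∫⁻ x : E3, H (x 0, √(x 1 ^ 2 + x 2 ^ 2)) := by
    rw [← lintegral_indicator Metric.isOpen_ball.measurableSet]
    refine lintegral_congr fun x => ?_
    simp only [hHdef, indicator, Metric.mem_ball, dist_zero_right, mem_ofPred_eq, hn x]
  rw [h3, h2] at h1
  have h4 : ∀ ρ ∈ Ioi (0 : ℝ), ∫⁻ θ in Ioo 0 Real.pi, ENNReal.ofReal (ρ ^ 2) *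
      (ENNReal.ofReal (Real.sin θ) * H (ρ * Real.cos θ, ρ * Real.sin θ)) =
      (Ioo (0 : ℝ) 1).indicator (fun ρ => ENNReal.ofReal (ρ ^ 2)) ρ *
        ∫⁻ t in Ioo (-1 : ℝ) 1, f t := by
    intro ρ hρ
    have hρ' : (0 : ℝ) < ρ := hρ
    have h5 : ∀ θ : ℝ, √((ρ * Real.cos θ) ^ 2 + (ρ * Real.sin θ) ^ 2) = ρ := by
      intro θ
      rw [show (ρ * Real.cos θ) ^ 2 + (ρ * Real.sin θ) ^ 2 =
        ρ ^ 2 * (Real.sin θ ^ 2 + Real.cos θ ^ 2) by ring, Real.sin_sq_add_cos_sq, mul_one,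
        Real.sqrt_sq hρ'.le]
    rw [← lintegral_sin_cos, lintegral_const_mul _ (by fun_prop)]
    by_cases h : ρ < 1
    · rw [indicator_of_mem (mem_Ioo.2 ⟨hρ', h⟩)]
      congr 1
      refine lintegral_congr fun θ => ?_
      simp only [hHdef]
      rw [indicator_of_mem (by simp only [mem_ofPred_eq, h5, h])]
      rw [h5, mul_div_cancel_left₀ _ hρ'.ne']
    · rw [indicator_of_notMem (fun h' => h h'.2)]
      have : ∀ θ : ℝ, H (ρ * Real.cos θ, ρ * Real.sin θ) = 0 := by
        intro θ
        simp only [hHdef]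
        rw [indicator_of_notMem (by simpa only [mem_ofPred_eq, h5] using h)]
      simp [this]
  rw [setLIntegral_congr_fun measurableSet_Ioi h4, lintegral_mul_const _
    (Measurable.indicator (by fun_prop) measurableSet_Ioo),
    lintegral_indicator measurableSet_Ioo, Measure.restrict_restrict measurableSet_Ioo,
    inter_eq_left.2 Ioo_subset_Ioi_self, mul_left_comm] at h1
  have h6 := (ENNReal.mul_right_inj radial_weight_ne_zero radial_weight_ne_top).1 h1
  rw [h6]
  simp

/-- Archimedes' hat-box theorem. -/
theorem lintegral_surf_inner {f : ℝ → ℝ≥0∞} (hf : Measurable f) (e : S2) :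
    ∫⁻ ν : S2, f (inner ℝ (e : E3) (ν : E3)) ∂surf =
      ENNReal.ofReal (2 * Real.pi) * ∫⁻ t in Ioo (-1 : ℝ) 1, f t := by
  rw [← lintegral_surf_coord hf]
  set e₀ : E3 := EuclideanSpace.single 0 1
  have he : ‖(e : E3)‖ = ‖e₀‖ := by simp [e₀]
  -- The reflection that exchanges `e` and `e₀` preserves volume and the unit ball, which reduces an
  -- arbitrary axis to the first coordinate axis.
  set T : E3 ≃ₗᵢ[ℝ] E3 := (ℝ ∙ ((e : E3) - e₀))ᗮ.reflection
  have hT : T e = e₀ := Submodule.reflection_sub he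
  have h0 : ∀ u : E3, ‖u‖ = 1 → ∫⁻ x in Metric.ball (0 : E3) 1, f (inner ℝ u x / ‖x‖) =
      (∫⁻ s in Ioo (0 : ℝ) 1, ENNReal.ofReal (s ^ 2)) *
        ∫⁻ ν : S2, f (inner ℝ u (ν : E3)) ∂surf := by
    intro u hu
    rw [lintegral_ball_homogeneous (f := fun x => f (inner ℝ u x / ‖x‖)) (by fun_prop) (by
      intro s hs x
      congr 1
      simp only [inner_smul_right, norm_smul, Real.norm_eq_abs, abs_of_pos hs]
      rw [mul_div_mul_left _ _ hs.ne'])]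
    simp
  have h1 := h0 e (by simp)
  have h2 := h0 e₀ (by simp [e₀])
  have h3 : ∫⁻ x in Metric.ball (0 : E3) 1, f (inner ℝ (e : E3) x / ‖x‖) =
      ∫⁻ x in Metric.ball (0 : E3) 1, f (inner ℝ e₀ x / ‖x‖) := by
    have := T.measurePreserving.setLIntegral_comp_preimage (s := Metric.ball (0 : E3) 1)
      Metric.isOpen_ball.measurableSet (f := fun x => f (inner ℝ e₀ x / ‖x‖)) (by fun_prop)
    rw [← this]
    have hb : T ⁻¹' Metric.ball (0 : E3) 1 = Metric.ball (0 : E3) 1 := by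
      ext x; simp
    rw [hb]
    simp only [← hT, T.inner_map_map, T.norm_map]
  rw [h1, h2] at h3
  rw [(ENNReal.mul_right_inj radial_weight_ne_zero radial_weight_ne_top).1 h3]
  refine lintegral_congr fun ν => ?_
  congr 1
  simp [e₀, EuclideanSpace.inner_single_left]

theorem surf_univ : surf univ = ENNReal.ofReal (4 * Real.pi) := by
  have := lintegral_surf_coord (f := fun _ => 1) measurable_const
  simp only [lintegral_const, one_mul, Measure.restrict_apply_univ, Real.volume_Ioo] at this
  rw [this, ← ENNReal.ofReal_mul (by positivity)]
  congr 1; ring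

/-! ### The Newtonian kernel and the shell theorem. -/

/-- The Newtonian kernel `1 / |x - y|`, infinite on the diagonal. -/
def newtonKernel (x y : E3) : ℝ≥0∞ := (ENNReal.ofReal (dist x y))⁻¹

@[fun_prop]
theorem measurable_newtonKernel : Measurable (fun p : E3 × E3 => newtonKernel p.1 p.2) := by
  unfold newtonKernel; fun_prop

theorem coulombKernel_eq {ε₀ : ℝ} (h : 0 < ε₀) (x y : E3) :
    coulombKernel ε₀ x y = (ENNReal.ofReal (4 * Real.pi * ε₀))⁻¹ * newtonKernel x y := by
  have : 0 < 4 * Real.pi * ε₀ := by positivity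
  rw [coulombKernel, newtonKernel, ENNReal.ofReal_mul this.le, ENNReal.mul_inv]
  · left; simpa using this
  · left; exact ENNReal.ofReal_ne_top

/-- An antiderivative is `-√(s ^ 2 + r ^ 2 - 2 * s * r * t) / (s * r)`. Its endpoint values involve
`s + r` and `|s - r|`, and the absolute value produces the maximum. For `s = r` the integrand is
unbounded at `t = 1`; integrability then follows from nonnegativity and continuity of the
antiderivative. -/
theorem lintegral_inv_sqrt {s r : ℝ} (hs : 0 < s) (hr : 0 < r) :
    ∫⁻ t in Ioo (-1 : ℝ) 1, (ENNReal.ofReal √(s ^ 2 + r ^ 2 - 2 * s * r * t))⁻¹ =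
      ENNReal.ofReal (2 / max r s) := by
  have hpos : ∀ t ∈ Ioo (-1 : ℝ) 1, 0 < s ^ 2 + r ^ 2 - 2 * s * r * t := by
    intro t ht
    nlinarith [sq_nonneg (s - r), mul_pos (mul_pos hs hr) (sub_pos.2 ht.2)]
  set G : ℝ → ℝ := fun t => -√(s ^ 2 + r ^ 2 - 2 * s * r * t) / (s * r) with hG
  have hd : ∀ t ∈ Ioo (-1 : ℝ) 1, HasDerivAt G (√(s ^ 2 + r ^ 2 - 2 * s * r * t))⁻¹ t := by
    intro t ht
    have h1 : HasDerivAt (fun t : ℝ => s ^ 2 + r ^ 2 - 2 * s * r * t) (-(2 * s * r)) t := by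
      simpa using ((hasDerivAt_id t).const_mul (2 * s * r)).const_sub (s ^ 2 + r ^ 2)
    have h2 := ((h1.sqrt (hpos t ht).ne').neg).div_const (s * r)
    have := Real.sqrt_pos.2 (hpos t ht)
    refine h2.congr_deriv ?_
    field_simp
  have hc : ContinuousOn G (Icc (-1) 1) := by
    apply Continuous.continuousOn; simp only [hG]; fun_prop
  have hnn : ∀ t ∈ Ioo (-1 : ℝ) 1, 0 ≤ (√(s ^ 2 + r ^ 2 - 2 * s * r * t))⁻¹ :=
    fun t _ => by positivity
  have hint := intervalIntegral.integrableOn_deriv_of_nonneg hc hd hnn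
  have hi := intervalIntegral.integral_eq_sub_of_hasDerivAt_of_le (by norm_num) hc hd
    ((intervalIntegrable_iff_integrableOn_Ioc_of_le (by norm_num)).2 hint)
  have h1 : ∫⁻ t in Ioo (-1 : ℝ) 1, (ENNReal.ofReal √(s ^ 2 + r ^ 2 - 2 * s * r * t))⁻¹ =
      ∫⁻ t in Ioo (-1 : ℝ) 1, ENNReal.ofReal (√(s ^ 2 + r ^ 2 - 2 * s * r * t))⁻¹ := by
    refine setLIntegral_congr_fun measurableSet_Ioo fun t ht => ?_
    rw [ENNReal.ofReal_inv_of_pos (Real.sqrt_pos.2 (hpos t ht))]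
  rw [h1, setLIntegral_congr Ioo_ae_eq_Ioc, ← ofReal_integral_eq_lintegral_ofReal hint,
    ← intervalIntegral.integral_of_le (by norm_num), hi]
  · congr 1
    simp only [hG]
    have e1 : s ^ 2 + r ^ 2 - 2 * s * r * 1 = (s - r) ^ 2 := by ring
    have e2 : s ^ 2 + r ^ 2 - 2 * s * r * (-1) = (s + r) ^ 2 := by ring
    rw [e1, e2, Real.sqrt_sq_eq_abs, Real.sqrt_sq (by positivity)]
    rcases le_total r s with h | h
    · rw [max_eq_right h, abs_of_nonneg (by linarith)]; field_simp; ring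
    · rw [max_eq_left h, abs_of_nonpos (by linarith)]; field_simp; ring
  · exact Filter.Eventually.of_forall fun t => by positivity

/-- Newton's shell theorem. -/
theorem lintegral_newtonKernel_surf (x c : E3) {r : ℝ} (hr : 0 < r) :
    ∫⁻ ν : S2, newtonKernel x (c + r • (ν : E3)) ∂surf =
      ENNReal.ofReal (4 * Real.pi) * (ENNReal.ofReal (max r (dist x c)))⁻¹ := by
  have hdist : ∀ ν : S2, dist x (c + r • (ν : E3)) = ‖(x - c) - r • (ν : E3)‖ := by
    intro ν; rw [dist_eq_norm]; congr 1; abel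
  rcases eq_or_ne x c with rfl | hxc
  · have : ∀ ν : S2, newtonKernel x (x + r • (ν : E3)) = (ENNReal.ofReal r)⁻¹ := by
      intro ν
      rw [newtonKernel, hdist]
      simp [norm_smul, abs_of_pos hr]
    simp only [this, lintegral_const, surf_univ, dist_self, max_eq_left hr.le]
    rw [mul_comm]
  set s := ‖x - c‖ with hs
  have hs0 : 0 < s := norm_pos_iff.2 (sub_ne_zero.2 hxc)
  set e : S2 := ⟨s⁻¹ • (x - c), by
    rw [mem_sphere_zero_iff_norm, norm_smul, norm_inv, Real.norm_eq_abs, abs_of_pos hs0, ← hs,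
      inv_mul_cancel₀ hs0.ne']⟩ with he
  have hse : x - c = s • (e : E3) := by
    simp only [he]; rw [smul_inv_smul₀ hs0.ne']
  have h1 : ∀ ν : S2, newtonKernel x (c + r • (ν : E3)) =
      (fun t : ℝ => (ENNReal.ofReal √(s ^ 2 + r ^ 2 - 2 * s * r * t))⁻¹)
        (inner ℝ (e : E3) (ν : E3)) := by
    intro ν
    rw [newtonKernel, hdist, hse]
    dsimp only
    congr 2
    rw [← Real.sqrt_sq (norm_nonneg (s • (e : E3) - r • (ν : E3))), norm_sub_sq_real]
    congr 1
    simp only [norm_smul, norm_eq_of_mem_sphere, inner_smul_left, inner_smul_right,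
      Real.norm_eq_abs, mul_one, sq_abs, conj_trivial]
    ring
  simp only [h1]
  rw [lintegral_surf_inner (f := fun t : ℝ =>
      (ENNReal.ofReal √(s ^ 2 + r ^ 2 - 2 * s * r * t))⁻¹) (by fun_prop) e,
    lintegral_inv_sqrt hs0 hr, ← ENNReal.ofReal_mul (by positivity), dist_eq_norm, ← hs,
    ← ENNReal.ofReal_inv_of_pos (by positivity), ← ENNReal.ofReal_mul (by positivity)]
  congr 1; ring

/-- The uniform probability measure on the sphere of radius `r` around `c`. -/
def sphereMeasure (c : E3) (r : ℝ) : Measure E3 :=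
  (ENNReal.ofReal (4 * Real.pi))⁻¹ • surf.map (fun ν : S2 => c + r • (ν : E3))

theorem ofReal_four_pi_ne_zero : ENNReal.ofReal (4 * Real.pi) ≠ 0 := by
  simpa using Real.pi_pos

theorem lintegral_sphereMeasure {f : E3 → ℝ≥0∞} (hf : Measurable f) (c : E3) (r : ℝ) :
    ∫⁻ y, f y ∂(sphereMeasure c r) =
      (ENNReal.ofReal (4 * Real.pi))⁻¹ * ∫⁻ ν : S2, f (c + r • (ν : E3)) ∂surf := by
  rw [sphereMeasure, lintegral_smul_measure, lintegral_map hf (by fun_prop), smul_eq_mul]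

instance (c : E3) (r : ℝ) : IsProbabilityMeasure (sphereMeasure c r) := by
  constructor
  have := lintegral_sphereMeasure (f := fun _ => 1) measurable_const c r
  simp only [lintegral_const, one_mul, surf_univ] at this
  rw [this, ENNReal.inv_mul_cancel ofReal_four_pi_ne_zero ENNReal.ofReal_ne_top]

theorem sphereMeasure_apply_of_sphere_subset {c : E3} {r : ℝ} (hr : 0 ≤ r) {s : Set E3}
    (hs : MeasurableSet s) (h : Metric.sphere c r ⊆ s) : sphereMeasure c r sᶜ = 0 := by
  rw [sphereMeasure, Measure.smul_apply, Measure.map_apply (by fun_prop) hs.compl]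
  have : (fun ν : S2 => c + r • (ν : E3)) ⁻¹' sᶜ = ∅ := by
    rw [eq_empty_iff_forall_notMem]
    intro ν hν
    exact hν (h (by simp [norm_smul, abs_of_nonneg hr]))
  simp [this]

theorem lintegral_newtonKernel_sphereMeasure (x c : E3) {r : ℝ} (hr : 0 < r) :
    ∫⁻ y, newtonKernel x y ∂(sphereMeasure c r) = (ENNReal.ofReal (max r (dist x c)))⁻¹ := by
  rw [lintegral_sphereMeasure (by fun_prop), lintegral_newtonKernel_surf x c hr, ← mul_assoc,
    ENNReal.inv_mul_cancel ofReal_four_pi_ne_zero ENNReal.ofReal_ne_top, one_mul]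

/-- The mutual Newtonian energy of two charge distributions. -/
def mutualEnergy (μ ν : Measure E3) : ℝ≥0∞ := ∫⁻ x, ∫⁻ y, newtonKernel x y ∂ν ∂μ

/-- The shell theorem applied twice: a uniform sphere has at most the potential of a point charge at
its centre, and averaging that potential over the other sphere again replaces the sphere by its
centre. The spheres may intersect. -/
theorem mutualEnergy_sphereMeasure_le_dist (c c' : E3) {r r' : ℝ} (hr : 0 < r) (hr' : 0 < r') :
    mutualEnergy (sphereMeasure c r) (sphereMeasure c' r') ≤ (ENNReal.ofReal (dist c c'))⁻¹ := by
  simp only [mutualEnergy, lintegral_newtonKernel_sphereMeasure _ _ hr']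
  calc ∫⁻ x, (ENNReal.ofReal (max r' (dist x c')))⁻¹ ∂(sphereMeasure c r)
      ≤ ∫⁻ x, newtonKernel c' x ∂(sphereMeasure c r) := by
        refine lintegral_mono fun x => ?_
        rw [newtonKernel, dist_comm]
        exact ENNReal.inv_le_inv.2 (ENNReal.ofReal_le_ofReal (le_max_right _ _))
    _ = (ENNReal.ofReal (max r (dist c' c)))⁻¹ := lintegral_newtonKernel_sphereMeasure _ _ hr
    _ ≤ _ := by
        rw [dist_comm]
        exact ENNReal.inv_le_inv.2 (ENNReal.ofReal_le_ofReal (le_max_right _ _))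

theorem mutualEnergy_sphereMeasure_le_radius (c c' : E3) {r r' : ℝ} (hr' : 0 < r') :
    mutualEnergy (sphereMeasure c r) (sphereMeasure c' r') ≤ (ENNReal.ofReal r')⁻¹ := by
  simp only [mutualEnergy, lintegral_newtonKernel_sphereMeasure _ _ hr']
  calc ∫⁻ x, (ENNReal.ofReal (max r' (dist x c')))⁻¹ ∂(sphereMeasure c r)
      ≤ ∫⁻ x, (ENNReal.ofReal r')⁻¹ ∂(sphereMeasure c r) := by
        refine lintegral_mono fun x => ?_
        exact ENNReal.inv_le_inv.2 (ENNReal.ofReal_le_ofReal (le_max_left _ _))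
    _ = _ := by simp

/-! ### Positive definiteness of the Newtonian kernel. -/

/-- The inverse-square kernel, a convolution square root of the Newtonian one. -/
def inverseSquare (v : E3) : ℝ≥0∞ := (ENNReal.ofReal (‖v‖ ^ 2))⁻¹

@[fun_prop]
theorem measurable_inverseSquare : Measurable inverseSquare := by
  unfold inverseSquare; fun_prop

theorem inverseSquare_ne_zero (v : E3) : inverseSquare v ≠ 0 := by
  simp [inverseSquare]

theorem inverseSquare_smul {a : ℝ} (ha : 0 < a) (v : E3) :
    inverseSquare (a • v) = (ENNReal.ofReal (a ^ 2))⁻¹ * inverseSquare v := by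
  have h : 0 < a ^ 2 := by positivity
  rw [inverseSquare, inverseSquare, norm_smul, mul_pow, Real.norm_eq_abs, sq_abs,
    ENNReal.ofReal_mul h.le, ENNReal.mul_inv (by left; simpa using ha.ne')
    (by left; exact ENNReal.ofReal_ne_top)]

theorem lintegral_comp_smul {f : E3 → ℝ≥0∞} (hf : Measurable f) {a : ℝ} (ha : 0 < a) :
    ∫⁻ z, f z = ENNReal.ofReal (a ^ 3) * ∫⁻ u, f (a • u) := by
  have h1 : ∫⁻ u, f (a • u) = ∫⁻ z, f z ∂(Measure.map (a • ·) (volume : Measure E3)) := by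
    rw [lintegral_map hf (by fun_prop)]
  have h3 : (0 : ℝ) < a ^ 3 := by positivity
  rw [h1, Measure.map_addHaar_smul _ ha.ne', lintegral_smul_measure, smul_eq_mul, ← mul_assoc,
    ← ENNReal.ofReal_mul h3.le]
  simp [abs_of_pos ha, h3.ne']

/-- The Riesz composition of the inverse-square kernel with itself. -/
def rieszKernel (x y : E3) : ℝ≥0∞ := ∫⁻ z, inverseSquare (x - z) * inverseSquare (y - z)

/-- The same similarity is substituted in the integration variable: the volume contributes `a ^ 3`
and the two kernels contribute `a ^ (-4)`. -/
theorem rieszKernel_similarity (y u v : E3) (T : E3 ≃ₗᵢ[ℝ] E3) {a : ℝ} (ha : 0 < a) :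
    rieszKernel (y + a • T u) (y + a • T v) = (ENNReal.ofReal a)⁻¹ * rieszKernel u v := by
  have hT : ∀ w, inverseSquare (T w) = inverseSquare w := fun w => by
    simp [inverseSquare]
  have h1 : ∀ w z : E3, y + a • T w - (y + a • T z) = a • T (w - z) := by
    intro w z; rw [map_sub, smul_sub]; abel
  rw [rieszKernel, ← lintegral_add_left_eq_self _ y, lintegral_comp_smul (by fun_prop) ha,
    ← T.measurePreserving.lintegral_comp (by fun_prop)]
  simp only [h1, inverseSquare_smul ha, hT]
  have h2 : ∀ z, (ENNReal.ofReal (a ^ 2))⁻¹ * inverseSquare (u - z) *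
      ((ENNReal.ofReal (a ^ 2))⁻¹ * inverseSquare (v - z)) =
      (ENNReal.ofReal (a ^ 4))⁻¹ * (inverseSquare (u - z) * inverseSquare (v - z)) := by
    intro z
    rw [mul_mul_mul_comm, ← ENNReal.ofReal_inv_of_pos (by positivity),
      ← ENNReal.ofReal_inv_of_pos (by positivity), ← ENNReal.ofReal_mul (by positivity)]
    congr 2; field_simp
  simp only [h2]
  rw [lintegral_const_mul _ (by fun_prop), ← mul_assoc, rieszKernel]
  congr 1
  rw [← ENNReal.ofReal_inv_of_pos (by positivity), ← ENNReal.ofReal_inv_of_pos (by positivity),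
    ← ENNReal.ofReal_mul (by positivity)]
  congr 1; field_simp

theorem rieszKernel_ne_zero (x y : E3) : rieszKernel x y ≠ 0 := by
  rw [rieszKernel, Ne, lintegral_eq_zero_iff (by fun_prop)]
  intro h
  have : ∀ᵐ z : E3, False := by
    filter_upwards [h] with z hz
    simp [inverseSquare_ne_zero] at hz
  simp only [Filter.eventually_false_iff_eq_bot, ae_eq_bot] at this
  exact NeZero.ne _ this

/-- In spherical coordinates the Jacobian cancels one inverse square, and what remains is at most
`4` near the origin and `s ^ (-2)` far away. -/
theorem lintegral_inverseSquare_min_lt_top :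
    ∫⁻ z, inverseSquare z * min 4 (inverseSquare z) < ⊤ := by
  rw [lintegral_polar (by fun_prop)]
  have h1 : ∀ (ν : S2), ∀ s ∈ Ioi (0 : ℝ), ENNReal.ofReal (s ^ 2) *
      (inverseSquare (s • (ν : E3)) * min 4 (inverseSquare (s • (ν : E3)))) ≤
      ENNReal.ofReal (8 * (1 + s ^ 2)⁻¹) := by
    intro ν s hs
    have hs : (0 : ℝ) < s := hs
    have e : inverseSquare (s • (ν : E3)) = ENNReal.ofReal (s ^ 2)⁻¹ := by
      rw [ENNReal.ofReal_inv_of_pos (by positivity)]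
      simp [inverseSquare, norm_smul]
    rw [e, ← mul_assoc, ← ENNReal.ofReal_mul (by positivity), mul_inv_cancel₀ (by positivity),
      ENNReal.ofReal_one, one_mul]
    rcases le_total s 1 with h | h
    · refine (min_le_left _ _).trans ?_
      rw [show (4 : ℝ≥0∞) = ENNReal.ofReal 4 by simp]
      apply ENNReal.ofReal_le_ofReal
      rw [← div_eq_mul_inv, le_div_iff₀ (by positivity)]
      nlinarith
    · refine (min_le_right _ _).trans (ENNReal.ofReal_le_ofReal ?_)
      rw [← div_eq_mul_inv, le_div_iff₀ (by positivity), inv_mul_le_iff₀ (by positivity)]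
      nlinarith
  have h2 : Integrable (fun s : ℝ => 8 * (1 + s ^ 2)⁻¹) := integrable_inv_one_add_sq.const_mul 8
  calc _ ≤ ∫⁻ ν : S2, ∫⁻ s in Ioi (0 : ℝ), ENNReal.ofReal (8 * (1 + s ^ 2)⁻¹) ∂volume ∂surf :=
        lintegral_mono fun ν => setLIntegral_mono (by fun_prop) (h1 ν)
    _ < ⊤ := by
      rw [lintegral_const]
      refine ENNReal.mul_lt_top ?_ (measure_lt_top _ _)
      exact (setLIntegral_le_lintegral _ _).trans_lt h2.lintegral_lt_top

/-- Of the distances from `z` to the two poles `e` and `0`, the larger is at least `1 / 2`, so the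
kernel at the farther pole is at most `4` and also at most the kernel at the nearer one. This
dominates the integrand by the truncated kernel around one pole or the other. -/
theorem rieszKernel_lt_top {e : E3} (he : ‖e‖ = 1) : rieszKernel e 0 < ⊤ := by
  set h : E3 → ℝ≥0∞ := fun z => inverseSquare z * min 4 (inverseSquare z) with hh
  have hneg : ∀ z, inverseSquare (0 - z) = inverseSquare z := by intro z; simp [inverseSquare]
  have key : ∀ u v : E3, 1 ≤ ‖u‖ + ‖v‖ → ‖v‖ ≤ ‖u‖ → inverseSquare u * inverseSquare v ≤ h v := by
    intro u v h1 h2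
    rw [hh, mul_comm]
    dsimp only
    gcongr
    refine le_min ?_ ?_
    · rw [inverseSquare, ENNReal.inv_le_iff_inv_le, show (4 : ℝ≥0∞) = ENNReal.ofReal 4 by simp,
        ← ENNReal.ofReal_inv_of_pos (by norm_num)]
      apply ENNReal.ofReal_le_ofReal
      nlinarith
    · rw [inverseSquare, inverseSquare]
      apply ENNReal.inv_le_inv.2 (ENNReal.ofReal_le_ofReal _)
      gcongr
  have hm : Measurable h := by rw [hh]; fun_prop
  calc rieszKernel e 0 ≤ ∫⁻ z, (h (e - z) + h z) := by
        refine lintegral_mono fun z => ?_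
        dsimp only
        rw [hneg]
        have h1 : 1 ≤ ‖e - z‖ + ‖z‖ := by
          rw [← he]; simpa using norm_add_le (e - z) z
        rcases le_total ‖z‖ ‖e - z‖ with h2 | h2
        · exact (key _ _ h1 h2).trans (self_le_add_left _ _)
        · rw [mul_comm]
          exact (key _ _ (by linarith) h2).trans (self_le_add_right _ _)
    _ = (∫⁻ z, h z) + ∫⁻ z, h z := by
        rw [lintegral_add_left (by fun_prop)]
        congr 1
        exact lintegral_sub_left_eq_self h e
    _ < ⊤ := by
        rw [ENNReal.add_lt_top]
        exact ⟨lintegral_inverseSquare_min_lt_top, lintegral_inverseSquare_min_lt_top⟩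

/-- Any two distinct points are the image of `e` and `0` under a similarity of ratio `‖x - y‖`, so
covariance alone determines the composition up to its value at one pair. The value of `κ` never
matters. -/
theorem exists_rieszKernel_eq :
    ∃ κ : ℝ≥0∞, κ ≠ 0 ∧ κ ≠ ⊤ ∧ ∀ x y, rieszKernel x y = κ * newtonKernel x y := by
  set e : E3 := EuclideanSpace.single 0 1
  have he : ‖e‖ = 1 := by simp [e]
  refine ⟨rieszKernel e 0, rieszKernel_ne_zero _ _, (rieszKernel_lt_top he).ne, fun x y => ?_⟩
  rcases eq_or_ne x y with rfl | hxy
  · have h1 : rieszKernel x x = ⊤ := by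
      -- On the diagonal, comparison of the ratios `2` and `1` shows that the value equals half of
      -- itself; being nonzero, it is infinite.
      have h2 := rieszKernel_similarity x 0 0 (LinearIsometryEquiv.refl ℝ E3) (a := 2) (by norm_num)
      have h3 := rieszKernel_similarity x 0 0 (LinearIsometryEquiv.refl ℝ E3) (a := 1) (by norm_num)
      simp only [LinearIsometryEquiv.coe_refl, id, smul_zero, add_zero, ENNReal.ofReal_one,
        inv_one, one_mul] at h2 h3
      rw [← h3] at h2
      by_contra h
      have h4 : (1 : ℝ≥0∞) * rieszKernel x x = (ENNReal.ofReal 2)⁻¹ * rieszKernel x x := by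
        rw [one_mul]; exact h2
      have h5 := (ENNReal.mul_left_inj (rieszKernel_ne_zero x x) h).1 h4
      have h6 := congrArg ENNReal.toReal h5
      norm_num at h6
    rw [h1, newtonKernel, dist_self]
    simp [rieszKernel_ne_zero]
  · have ha : 0 < ‖x - y‖ := norm_pos_iff.2 (sub_ne_zero.2 hxy)
    set u : E3 := ‖x - y‖⁻¹ • (x - y)
    have hu : ‖e‖ = ‖u‖ := by
      rw [he, norm_smul, norm_inv, norm_norm, inv_mul_cancel₀ ha.ne']
    have hT : (ℝ ∙ (e - u))ᗮ.reflection e = u := Submodule.reflection_sub hu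
    have h := rieszKernel_similarity y e 0 (ℝ ∙ (e - u))ᗮ.reflection ha
    rw [hT, map_zero, smul_zero, add_zero, smul_inv_smul₀ ha.ne', add_sub_cancel] at h
    rw [h, newtonKernel, dist_eq_norm, mul_comm]

theorem two_mul_le_add_sq_ennreal (a b : ℝ≥0∞) : 2 * (a * b) ≤ a * a + b * b := by
  rcases eq_or_ne a ⊤ with rfl | ha
  · simp
  rcases eq_or_ne b ⊤ with rfl | hb
  · simp
  lift a to NNReal using ha
  lift b to NNReal using hb
  norm_cast
  have := two_mul_le_add_sq a b
  nlinarith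

/-- Positive definiteness of the Newtonian kernel. -/
theorem two_mul_mutualEnergy_le (μ ν : Measure E3) [SFinite μ] [SFinite ν] :
    2 * mutualEnergy μ ν ≤ mutualEnergy μ μ + mutualEnergy ν ν := by
  obtain ⟨κ, h0, htop, hκ⟩ := exists_rieszKernel_eq
  -- By Tonelli the energy is an integral over `z` of a product of two inverse-square potentials,
  -- and the claim becomes `2 * a * b ≤ a ^ 2 + b ^ 2` pointwise. Staying in `ℝ≥0∞` avoids signed
  -- measures and finiteness assumptions.
  have key : ∀ (α β : Measure E3) [SFinite α] [SFinite β], κ * mutualEnergy α β =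
      ∫⁻ z, (∫⁻ x, inverseSquare (x - z) ∂α) * ∫⁻ y, inverseSquare (y - z) ∂β := by
    intro α β _ _
    have h1 : κ * mutualEnergy α β = ∫⁻ x, ∫⁻ y, rieszKernel x y ∂β ∂α := by
      simp only [hκ, mutualEnergy]
      rw [← lintegral_const_mul]
      · refine lintegral_congr fun x => ?_
        rw [lintegral_const_mul _ (by fun_prop)]
      · exact Measurable.lintegral_prod_right' (f := fun p => newtonKernel p.1 p.2) (by fun_prop)
    have h2 : ∀ x, ∫⁻ y, rieszKernel x y ∂β =
        ∫⁻ z, inverseSquare (x - z) * ∫⁻ y, inverseSquare (y - z) ∂β := by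
      intro x
      simp only [rieszKernel]
      rw [lintegral_lintegral_swap (by fun_prop)]
      refine lintegral_congr fun z => ?_
      rw [lintegral_const_mul _ (by fun_prop)]
    have hm : Measurable fun z => ∫⁻ y, inverseSquare (y - z) ∂β :=
      Measurable.lintegral_prod_right' (f := fun p : E3 × E3 => inverseSquare (p.2 - p.1))
        (by fun_prop)
    rw [h1]
    simp only [h2]
    rw [lintegral_lintegral_swap (by fun_prop)]
    refine lintegral_congr fun z => ?_
    rw [lintegral_mul_const _ (by fun_prop)]
  have hm : ∀ (β : Measure E3) [SFinite β], Measurable fun z => ∫⁻ y, inverseSquare (y - z) ∂β :=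
    fun β _ => Measurable.lintegral_prod_right'
      (f := fun p : E3 × E3 => inverseSquare (p.2 - p.1)) (by fun_prop)
  have h1 := hm μ
  have h2 := hm ν
  rw [← ENNReal.mul_le_mul_iff_right h0 htop, mul_add, mul_left_comm, key, key, key,
    ← lintegral_const_mul _ (by fun_prop), ← lintegral_add_left (by fun_prop)]
  exact lintegral_mono fun z => two_mul_le_add_sq_ennreal _ _

/-! ### Inverse capacitance of the ball, from below. -/

/-- The uniform charge on the boundary sphere has constant potential `1 / R` in the ball, so its
mutual energy with `μ` is exactly `1 / R`, and its self-energy is at most `1 / R`. Positive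
definiteness leaves at least `1 / R` for `μ`. -/
theorem inv_le_mutualEnergy_of_closedBall {R : ℝ} (hR : 0 < R) {μ : Measure E3}
    (h1 : μ (Metric.closedBall 0 R) = 1) (h0 : μ (Metric.closedBall 0 R)ᶜ = 0) :
    (ENNReal.ofReal R)⁻¹ ≤ mutualEnergy μ μ := by
  have hae : ∀ᵐ x ∂μ, x ∈ Metric.closedBall (0 : E3) R := by
    rw [ae_iff]; exact h0
  have huniv : μ univ = 1 := by
    rw [← measure_add_measure_compl (Metric.isClosed_closedBall (x := (0 : E3)) (ε := R)).measurableSet,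
      h1, h0, add_zero]
  have : IsProbabilityMeasure μ := ⟨huniv⟩
  have hpot : ∀ x ∈ Metric.closedBall (0 : E3) R,
      (ENNReal.ofReal (max R (dist x 0)))⁻¹ = (ENNReal.ofReal R)⁻¹ := by
    intro x hx; rw [max_eq_left (Metric.mem_closedBall.1 hx)]
  have e1 : mutualEnergy μ (sphereMeasure 0 R) = (ENNReal.ofReal R)⁻¹ := by
    simp only [mutualEnergy, lintegral_newtonKernel_sphereMeasure _ _ hR]
    rw [lintegral_congr_ae (hae.mono hpot)]
    simp
  have e2 := mutualEnergy_sphereMeasure_le_radius (0 : E3) 0 (r := R) hR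
  have h := two_mul_mutualEnergy_le μ (sphereMeasure 0 R)
  rw [e1, two_mul] at h
  have hne : (ENNReal.ofReal R)⁻¹ ≠ ⊤ := by simpa using hR
  exact (ENNReal.add_le_add_iff_right hne).1 (h.trans (by gcongr))

theorem setLIntegral_coulombKernel_eq {ε₀ : ℝ} (hε₀ : 0 < ε₀) {Ω : Set E3} {μ : Measure E3}
    (h : μ Ωᶜ = 0) :
    ∫⁻ x in Ω, ∫⁻ y in Ω, coulombKernel ε₀ x y ∂μ ∂μ =
      (ENNReal.ofReal (4 * Real.pi * ε₀))⁻¹ * mutualEnergy μ μ := by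
  have hr : μ.restrict Ω = μ := Measure.restrict_eq_self_of_ae_mem (by rw [ae_iff]; exact h)
  have hne : (ENNReal.ofReal (4 * Real.pi * ε₀))⁻¹ ≠ ⊤ := by
    have : 0 < 4 * Real.pi * ε₀ := by positivity
    simpa using this
  rw [hr]
  simp only [coulombKernel_eq hε₀, mutualEnergy]
  rw [← lintegral_const_mul' _ _ hne]
  exact lintegral_congr fun x => lintegral_const_mul' _ _ hne

/-- The ball has inverse capacitance at least (in fact, equal to) `1 / (4 π ε₀ R)`. -/
theorem le_inverseCapacitance_closedBall {ε₀ R : ℝ} (hε₀ : 0 < ε₀) (hR : 0 < R) :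
    ENNReal.ofReal (1 / (4 * Real.pi * ε₀) * (1 / R)) ≤
      inverseCapacitance ε₀ (Metric.closedBall 0 R) := by
  refine le_iInf fun μ => le_iInf fun h1 => le_iInf fun h0 => ?_
  rw [setLIntegral_coulombKernel_eq hε₀ h0, ENNReal.ofReal_mul (by positivity), one_div, one_div,
    ENNReal.ofReal_inv_of_pos (by positivity), ENNReal.ofReal_inv_of_pos hR]
  gcongr
  exact inv_le_mutualEnergy_of_closedBall hR h1 h0

/-! ### Inverse capacitance from above, by a test charge on spheres. -/

theorem measurable_lintegral_newtonKernel (μ : Measure E3) [SFinite μ] :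
    Measurable fun x => ∫⁻ y, newtonKernel x y ∂μ :=
  Measurable.lintegral_prod_right' (f := fun p => newtonKernel p.1 p.2) (by fun_prop)

theorem mutualEnergy_add_left (μ ν ρ : Measure E3) :
    mutualEnergy (μ + ν) ρ = mutualEnergy μ ρ + mutualEnergy ν ρ :=
  lintegral_add_measure _ _ _

theorem mutualEnergy_add_right (μ ν ρ : Measure E3) [SFinite ν] :
    mutualEnergy μ (ν + ρ) = mutualEnergy μ ν + mutualEnergy μ ρ := by
  simp only [mutualEnergy, lintegral_add_measure]
  exact lintegral_add_left (measurable_lintegral_newtonKernel ν) _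

theorem mutualEnergy_smul_left (a : ℝ≥0∞) (μ ν : Measure E3) :
    mutualEnergy (a • μ) ν = a * mutualEnergy μ ν := by
  rw [mutualEnergy, lintegral_smul_measure]; rfl

theorem mutualEnergy_smul_right (a : ℝ≥0∞) (μ ν : Measure E3) [SFinite ν] :
    mutualEnergy μ (a • ν) = a * mutualEnergy μ ν := by
  simp only [mutualEnergy, lintegral_smul_measure, smul_eq_mul]
  exact lintegral_const_mul _ (measurable_lintegral_newtonKernel ν)

theorem mutualEnergy_sum_left {ι : Type*} (s : Finset ι) (μ : ι → Measure E3) (ν : Measure E3) :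
    mutualEnergy (∑ i ∈ s, μ i) ν = ∑ i ∈ s, mutualEnergy (μ i) ν :=
  lintegral_finsetSum_measure _ _ _

theorem mutualEnergy_sum_right {ι : Type*} (s : Finset ι) (μ : Measure E3) (ν : ι → Measure E3)
    [∀ i, SFinite (ν i)] : mutualEnergy μ (∑ i ∈ s, ν i) = ∑ i ∈ s, mutualEnergy μ (ν i) := by
  simp only [mutualEnergy, lintegral_finsetSum_measure]
  exact lintegral_finsetSum _ fun i _ => measurable_lintegral_newtonKernel (ν i)

theorem mutualEnergy_sphereMeasure_le_ofReal_inv_dist (c c' : E3) {r r' m : ℝ} (hr : 0 < r)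
    (hr' : 0 < r') (hm : 0 < m) (h : m ≤ dist c c') :
    mutualEnergy (sphereMeasure c r) (sphereMeasure c' r') ≤ ENNReal.ofReal (1 / m) := by
  refine (mutualEnergy_sphereMeasure_le_dist c c' hr hr').trans ?_
  rw [one_div, ENNReal.ofReal_inv_of_pos hm]
  exact ENNReal.inv_le_inv.2 (ENNReal.ofReal_le_ofReal h)

theorem mutualEnergy_sphereMeasure_le_ofReal_inv_radius (c c' : E3) {r r' : ℝ} (hr' : 0 < r') :
    mutualEnergy (sphereMeasure c r) (sphereMeasure c' r') ≤ ENNReal.ofReal (1 / r') := by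
  refine (mutualEnergy_sphereMeasure_le_radius c c' hr').trans ?_
  rw [one_div, ENNReal.ofReal_inv_of_pos hr']

/-- The test charge `1 - q` on a large sphere and `q / n` on each of `n` small separated spheres. -/
theorem inverseCapacitance_le_of_spheres {ε₀ : ℝ} (hε₀ : 0 < ε₀) {Ω : Set E3}
    (hΩ : MeasurableSet Ω) {ρ r D m q : ℝ} (hρ : 0 < ρ) (hr : 0 < r) (hD : 0 < D) (hm : 0 < m)
    (hq : 0 ≤ q) (hq1 : q ≤ 1) {n : ℕ} (hn : 0 < n) (c : Fin n → E3)
    (h0 : Metric.sphere 0 ρ ⊆ Ω) (hc : ∀ i, Metric.sphere (c i) r ⊆ Ω)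
    (hcD : ∀ i, D ≤ ‖c i‖) (hsep : ∀ i j, i ≠ j → m ≤ dist (c i) (c j)) :
    inverseCapacitance ε₀ Ω ≤ ENNReal.ofReal (1 / (4 * Real.pi * ε₀) *
      ((1 - q) ^ 2 / ρ + 2 * (1 - q) * q / D + q ^ 2 * (1 / (n * r) + 1 / m))) := by
  have hn' : (0 : ℝ) < n := by exact_mod_cast hn
  have hq1' : 0 ≤ 1 - q := by linarith
  set lam := sphereMeasure 0 ρ with hlam
  set N : Measure E3 := ∑ i : Fin n, sphereMeasure (c i) r with hN
  set A := ENNReal.ofReal (1 - q)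
  set B := ENNReal.ofReal (q / n)
  set μ : Measure E3 := A • lam + B • N with hμ
  have hμ0 : μ Ωᶜ = 0 := by
    simp only [hμ, hN, Measure.add_apply, Measure.smul_apply, Measure.finsetSum_apply, hlam,
      sphereMeasure_apply_of_sphere_subset hρ.le hΩ h0,
      sphereMeasure_apply_of_sphere_subset hr.le hΩ (hc _)]
    simp
  have hμ1 : μ Ω = 1 := by
    have h : μ univ = 1 := by
      simp only [hμ, hN, Measure.add_apply, Measure.smul_apply, Measure.finsetSum_apply, hlam,
        measure_univ, A, B]
      simp only [Finset.sum_const, Finset.card_univ, Fintype.card_fin, nsmul_eq_mul, smul_eq_mul,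
        mul_one]
      rw [← ENNReal.ofReal_natCast, ← ENNReal.ofReal_mul (by positivity),
        ← ENNReal.ofReal_add hq1' (by positivity), ← ENNReal.ofReal_one]
      congr 1; field_simp; ring
    rw [← h, ← measure_add_measure_compl hΩ, hμ0, add_zero]
  refine (iInf_le_of_le μ (iInf_le_of_le hμ1 (iInf_le_of_le hμ0 le_rfl))).trans ?_
  rw [setLIntegral_coulombKernel_eq hε₀ hμ0,
    ENNReal.ofReal_mul (p := 1 / (4 * Real.pi * ε₀)) (by positivity), one_div,
    ENNReal.ofReal_inv_of_pos (by positivity)]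
  gcongr
  have e1 : mutualEnergy lam lam ≤ ENNReal.ofReal (1 / ρ) :=
    mutualEnergy_sphereMeasure_le_ofReal_inv_radius _ _ hρ
  have e2 : mutualEnergy lam N ≤ n * ENNReal.ofReal (1 / D) := by
    rw [hN, mutualEnergy_sum_right]
    refine (Finset.sum_le_sum fun i _ =>
      mutualEnergy_sphereMeasure_le_ofReal_inv_dist _ _ hρ hr hD ?_).trans (by simp)
    simpa using hcD i
  have e3 : mutualEnergy N lam ≤ n * ENNReal.ofReal (1 / D) := by
    rw [hN, mutualEnergy_sum_left]
    refine (Finset.sum_le_sum fun i _ =>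
      mutualEnergy_sphereMeasure_le_ofReal_inv_dist _ _ hr hρ hD ?_).trans (by simp)
    simpa using hcD i
  -- There are `n` self-energies and fewer than `n ^ 2` interactions; the weights `(q / n) ^ 2` turn
  -- this into `q ^ 2 * (1 / (n * r) + 1 / m)`.
  have e4 : mutualEnergy N N ≤ n * (ENNReal.ofReal (1 / r) + n * ENNReal.ofReal (1 / m)) := by
    rw [hN, mutualEnergy_sum_left]
    have : ∀ i ∈ Finset.univ, mutualEnergy (sphereMeasure (c i) r)
        (∑ i : Fin n, sphereMeasure (c i) r) ≤ ENNReal.ofReal (1 / r) +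
          n * ENNReal.ofReal (1 / m) := by
      intro i _
      rw [mutualEnergy_sum_right, ← Finset.add_sum_erase _ _ (Finset.mem_univ i)]
      refine add_le_add (mutualEnergy_sphereMeasure_le_ofReal_inv_radius _ _ hr) ?_
      calc _ ≤ ∑ j ∈ Finset.univ.erase i, ENNReal.ofReal (1 / m) :=
            Finset.sum_le_sum fun j hj => mutualEnergy_sphereMeasure_le_ofReal_inv_dist _ _ hr hr hm
              (hsep i j (Finset.ne_of_mem_erase hj).symm)
        _ ≤ ∑ j : Fin n, ENNReal.ofReal (1 / m) :=
            Finset.sum_le_sum_of_subset (Finset.erase_subset _ _)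
        _ = _ := by simp
    refine (Finset.sum_le_sum this).trans (by simp [mul_add])
  have e5 : mutualEnergy μ μ = A * (A * mutualEnergy lam lam) + A * (B * mutualEnergy lam N) +
      (B * (A * mutualEnergy N lam) + B * (B * mutualEnergy N N)) := by
    simp only [hμ, mutualEnergy_add_left, mutualEnergy_smul_left]
    rw [mutualEnergy_add_right, mutualEnergy_smul_right, mutualEnergy_smul_right,
      mutualEnergy_add_right, mutualEnergy_smul_right, mutualEnergy_smul_right, mul_add, mul_add]
  rw [e5]
  calc _ ≤ A * (A * ENNReal.ofReal (1 / ρ)) + A * (B * (n * ENNReal.ofReal (1 / D))) +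
      (B * (A * (n * ENNReal.ofReal (1 / D))) + B * (B * (n * (ENNReal.ofReal (1 / r) +
        n * ENNReal.ofReal (1 / m))))) := by gcongr
    _ = _ := by
      simp only [A, B]
      rw [← ENNReal.ofReal_natCast]
      simp (disch := positivity) only [← ENNReal.ofReal_mul, ← ENNReal.ofReal_add]
      congr 1
      field_simp
      ring

/-! ### Perimeter of radial graphs, from above. -/

/-- The signed radial distance of `x` from the boundary of `starSet R G`. -/
def radialExcess (R : ℝ) (G : E3 → ℝ) (x : E3) : ℝ := ‖x‖ - R - G (‖x‖⁻¹ • x)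

theorem mem_starSet_iff {R : ℝ} {G : E3 → ℝ} {x : E3} (hx : x ≠ 0) :
    x ∈ starSet R (fun ν => G ν) ↔ radialExcess R G x ≤ 0 := by
  simp only [starSet, mem_ofPred_eq, hx, ne_eq, not_false_eq_true, forall_true_left, direction,
    radialExcess]
  constructor <;> intro h <;> linarith

theorem zero_mem_starSet (R : ℝ) (φ : S2 → ℝ) : (0 : E3) ∈ starSet R φ := fun h => absurd rfl h

theorem radialExcess_smul {R : ℝ} {G : E3 → ℝ} (ν : S2) {s : ℝ} (hs : 0 < s) :
    radialExcess R G (s • (ν : E3)) = s - R - G ν := by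
  have : ‖s • (ν : E3)‖ = s := by simp [norm_smul, abs_of_pos hs]
  rw [radialExcess, this, inv_smul_smul₀ hs.ne']

theorem measurableSet_starSet (R : ℝ) {G : E3 → ℝ} (hG : Continuous G) :
    MeasurableSet (starSet R (fun ν => G ν)) := by
  have : starSet R (fun ν => G ν) = {0} ∪ {x | radialExcess R G x ≤ 0} ∩ {0}ᶜ := by
    ext x
    rcases eq_or_ne x 0 with rfl | hx
    · simp [zero_mem_starSet]
    · simp [mem_starSet_iff hx, hx]
  rw [this]
  have hm : Measurable (radialExcess R G) := by
    unfold radialExcess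
    exact (by fun_prop : Measurable fun x : E3 => ‖x‖ - R).sub (hG.measurable.comp (by fun_prop))
  exact (measurableSet_singleton _).union
    ((measurableSet_le hm measurable_const).inter (measurableSet_singleton _).compl)

theorem contDiffAt_radialExcess {n : WithTop ℕ∞} (R : ℝ) {G : E3 → ℝ} (hG : ContDiff ℝ n G) {x : E3}
    (hx : x ≠ 0) : ContDiffAt ℝ n (radialExcess R G) x := by
  have hn : ContDiffAt ℝ n (fun x : E3 => ‖x‖) x := contDiffAt_norm ℝ hx
  unfold radialExcess
  refine (hn.sub contDiffAt_const).sub (hG.contDiffAt.comp x ?_)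
  exact (hn.inv (norm_ne_zero_iff.2 hx)).smul contDiffAt_id

/-- The product rule bounds the derivative of `x / ‖x‖` by `2 / ‖x‖`. The sharp constant is `1`, but
the slope enters only through the order of magnitude of the perimeter excess. -/
theorem norm_fderiv_radialExcess_le (R : ℝ) {G : E3 → ℝ} (hG : ContDiff ℝ 1 G) {x : E3}
    (hx : x ≠ 0) :
    ‖fderiv ℝ (radialExcess R G) x‖ ≤ 1 + 2 * ‖fderiv ℝ G (‖x‖⁻¹ • x)‖ / ‖x‖ := by
  have hx' : 0 < ‖x‖ := norm_pos_iff.2 hx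
  have hn : HasFDerivAt (fun x : E3 => ‖x‖) (fderiv ℝ (fun x : E3 => ‖x‖) x) x :=
    ((contDiffAt_norm ℝ (n := 1) hx).differentiableAt (by simp)).hasFDerivAt
  have hn1 : ‖fderiv ℝ (fun x : E3 => ‖x‖) x‖ ≤ 1 := by
    simpa using norm_fderiv_le_of_lipschitz ℝ (lipschitzWith_one_norm (E := E3)) (x₀ := x)
  set N := fderiv ℝ (fun x : E3 => ‖x‖) x
  have hi : HasFDerivAt (fun x : E3 => ‖x‖⁻¹) (-(‖x‖ ^ 2)⁻¹ • N) x :=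
    (hasDerivAt_inv hx'.ne').comp_hasFDerivAt x hn
  have hp : HasFDerivAt (fun x : E3 => ‖x‖⁻¹ • x)
      (‖x‖⁻¹ • ContinuousLinearMap.id ℝ E3 + (-(‖x‖ ^ 2)⁻¹ • N).smulRight x) x :=
    hi.smul (hasFDerivAt_id x)
  have hGd : HasFDerivAt G (fderiv ℝ G (‖x‖⁻¹ • x)) (‖x‖⁻¹ • x) :=
    (hG.differentiable (by simp) _).hasFDerivAt
  have hc := HasFDerivAt.comp (f := fun x : E3 => ‖x‖⁻¹ • x) x hGd hp
  have hr : HasFDerivAt (radialExcess R G) (N - (fderiv ℝ G (‖x‖⁻¹ • x)).comp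
      (‖x‖⁻¹ • ContinuousLinearMap.id ℝ E3 + (-(‖x‖ ^ 2)⁻¹ • N).smulRight x)) x :=
    (hn.sub_const R).sub hc
  rw [hr.fderiv]
  have hproj : ‖‖x‖⁻¹ • ContinuousLinearMap.id ℝ E3 + (-(‖x‖ ^ 2)⁻¹ • N).smulRight x‖ ≤
      2 / ‖x‖ := by
    refine (norm_add_le _ _).trans ?_
    rw [ContinuousLinearMap.norm_smulRight_apply, norm_smul, norm_smul, norm_neg, norm_inv,
      norm_inv, norm_pow, norm_norm]
    have h1 : ‖ContinuousLinearMap.id ℝ E3‖ ≤ 1 := ContinuousLinearMap.norm_id_le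
    calc ‖x‖⁻¹ * ‖ContinuousLinearMap.id ℝ E3‖ + (‖x‖ ^ 2)⁻¹ * ‖N‖ * ‖x‖
        ≤ ‖x‖⁻¹ * 1 + (‖x‖ ^ 2)⁻¹ * 1 * ‖x‖ := by gcongr
      _ = 2 / ‖x‖ := by field_simp; ring
  refine (norm_sub_le _ _).trans (add_le_add hn1 ?_)
  refine (ContinuousLinearMap.opNorm_comp_le _ _).trans ?_
  calc _ ≤ ‖fderiv ℝ G (‖x‖⁻¹ • x)‖ * (2 / ‖x‖) := by gcongr
    _ = _ := by ring

theorem deriv_smoothTransition_nonneg (t : ℝ) : 0 ≤ deriv Real.smoothTransition t :=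
  Real.smoothTransition.monotone.deriv_nonneg

theorem deriv_smoothTransition_eq_zero {t : ℝ} (ht : t ∉ Icc (0 : ℝ) 1) :
    deriv Real.smoothTransition t = 0 := by
  rw [mem_Icc, not_and_or, not_le, not_le] at ht
  rcases ht with ht | ht
  · have : Real.smoothTransition =ᶠ[𝓝 t] fun _ => 0 := by
      filter_upwards [gt_mem_nhds ht] with s hs
      exact Real.smoothTransition.zero_of_nonpos (le_of_lt hs)
    rw [this.deriv_eq, deriv_const]
  · have : Real.smoothTransition =ᶠ[𝓝 t] fun _ => 1 := by
      filter_upwards [lt_mem_nhds ht] with s hs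
      exact Real.smoothTransition.one_of_one_le (le_of_lt hs)
    rw [this.deriv_eq, deriv_const]

theorem hasDerivAt_smoothTransition (t : ℝ) :
    HasDerivAt Real.smoothTransition (deriv Real.smoothTransition t) t :=
  ((Real.smoothTransition.contDiff (n := 1)).differentiable (by simp) t).hasDerivAt

theorem continuous_deriv_smoothTransition : Continuous (deriv Real.smoothTransition) :=
  (Real.smoothTransition.contDiff (n := 1)).continuous_deriv (by simp)

theorem lintegral_deriv_smoothTransition (a : ℝ) {ε : ℝ} (hε : 0 < ε) :
    ∫⁻ s in Icc a (a + ε), ENNReal.ofReal (deriv Real.smoothTransition ((s - a) / ε) / ε) = 1 := by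
  have hc := continuous_deriv_smoothTransition
  have hd : ∀ s : ℝ, HasDerivAt (fun s => Real.smoothTransition ((s - a) / ε))
      (deriv Real.smoothTransition ((s - a) / ε) / ε) s := by
    intro s
    have h1 : HasDerivAt (fun s : ℝ => (s - a) / ε) (1 / ε) s :=
      ((hasDerivAt_id s).sub_const a).div_const ε
    refine ((hasDerivAt_smoothTransition _).comp s h1).congr_deriv ?_
    ring
  have hcont : Continuous fun s => deriv Real.smoothTransition ((s - a) / ε) / ε :=
    (hc.comp (by fun_prop)).div_const ε
  have hi := intervalIntegral.integral_eq_sub_of_hasDerivAt (a := a) (b := a + ε)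
    (fun s _ => hd s) (hcont.intervalIntegrable _ _)
  rw [setLIntegral_congr Ioc_ae_eq_Icc.symm, ← ofReal_integral_eq_lintegral_ofReal
    (hcont.intervalIntegrable a (a + ε)).1, ← intervalIntegral.integral_of_le (by linarith), hi]
  · simp [hε.ne']
  · refine Filter.Eventually.of_forall fun s => ?_
    exact div_nonneg (deriv_smoothTransition_nonneg _) hε.le

/-- A smooth approximation, as `ε → 0`, of the indicator function of `starSet R G`. -/
def starCutoff (R : ℝ) (G : E3 → ℝ) (ε : ℝ) (x : E3) : ℝ :=
  1 - Real.smoothTransition (radialExcess R G x / ε)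

section

variable {R : ℝ} {G : E3 → ℝ} {ε : ℝ}

/-- The norm is singular at the origin, but the graph stays at distance at least `R / 2` from it, so
the cutoff is locally constant there. -/
theorem starCutoff_eventuallyEq_one (hR : 0 < R) (hb : ∀ x, |G x| ≤ R / 2) (hε : 0 < ε) :
    starCutoff R G ε =ᶠ[𝓝 0] fun _ => 1 := by
  filter_upwards [Metric.ball_mem_nhds (0 : E3) (half_pos hR)] with x hx
  have h1 : ‖x‖ < R / 2 := by simpa using hx
  have h2 := neg_le_of_abs_le (hb (‖x‖⁻¹ • x))
  rw [starCutoff, Real.smoothTransition.zero_of_nonpos, sub_zero]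
  refine div_nonpos_of_nonpos_of_nonneg ?_ hε.le
  rw [radialExcess]; linarith

theorem contDiff_starCutoff (hG : ContDiff ℝ 1 G) (hR : 0 < R) (hb : ∀ x, |G x| ≤ R / 2)
    (hε : 0 < ε) : ContDiff ℝ 1 (starCutoff R G ε) := by
  rw [contDiff_iff_contDiffAt]
  intro x
  rcases eq_or_ne x 0 with rfl | hx
  · exact contDiffAt_const.congr_of_eventuallyEq (starCutoff_eventuallyEq_one hR hb hε)
  · unfold starCutoff
    refine contDiffAt_const.sub ?_
    exact (Real.smoothTransition.contDiff (n := 1)).contDiffAt.comp x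
      ((contDiffAt_radialExcess R hG hx).div_const ε)

theorem hasCompactSupport_starCutoff (hb : ∀ x, |G x| ≤ R / 2) (hε : 0 < ε) :
    HasCompactSupport (starCutoff R G ε) := by
  refine HasCompactSupport.intro (isCompact_closedBall (0 : E3) (R + R / 2 + ε)) fun x hx => ?_
  rw [Metric.mem_closedBall, dist_zero_right, not_le] at hx
  have h2 := (abs_le.1 (hb (‖x‖⁻¹ • x))).2
  rw [starCutoff, Real.smoothTransition.one_of_one_le, sub_self]
  rw [le_div_iff₀ hε, radialExcess]; linarith

theorem norm_fderiv_starCutoff_smul_le (hG : ContDiff ℝ 1 G) (hε : 0 < ε) (ν : S2) {s : ℝ}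
    (hs : 0 < s) :
    ‖fderiv ℝ (starCutoff R G ε) (s • (ν : E3))‖ ≤
      deriv Real.smoothTransition ((s - (R + G ν)) / ε) / ε * (1 + 2 * ‖fderiv ℝ G ν‖ / s) := by
  have hnorm : ‖s • (ν : E3)‖ = s := by simp [norm_smul, abs_of_pos hs]
  have hx : s • (ν : E3) ≠ 0 := by rw [← norm_pos_iff, hnorm]; exact hs
  have h1 : HasFDerivAt (fun x => radialExcess R G x / ε)
      (ε⁻¹ • fderiv ℝ (radialExcess R G) (s • (ν : E3))) (s • (ν : E3)) := by
    have := (((contDiffAt_radialExcess R hG hx).differentiableAt (by simp)).hasFDerivAt).const_mul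
      ε⁻¹
    simpa only [div_eq_inv_mul] using this
  have h2 : HasFDerivAt (starCutoff R G ε) _ (s • (ν : E3)) :=
    ((hasDerivAt_smoothTransition _).comp_hasFDerivAt _ h1).const_sub 1
  have h3 := norm_fderiv_radialExcess_le R hG hx
  rw [hnorm, inv_smul_smul₀ hs.ne'] at h3
  rw [h2.fderiv, norm_neg, norm_smul, norm_smul, radialExcess_smul ν hs, Real.norm_eq_abs,
    abs_of_nonneg (deriv_smoothTransition_nonneg _), norm_inv, Real.norm_eq_abs, abs_of_pos hε,
    sub_sub, ← mul_assoc, ← div_eq_mul_inv]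
  gcongr
  exact div_nonneg (deriv_smoothTransition_nonneg _) hε.le

/-- On each ray the cutoff descends from `1` to `0` between `R + G ν` and `R + G ν + ε`, so its
radial slope has integral `1`. The Jacobian `s ^ 2` and the tangential factor `1 + 2 * ‖fderiv ℝ G
ν‖ / s` are replaced by their bound at the outer end. -/
theorem lintegral_norm_fderiv_starCutoff_le (hG : ContDiff ℝ 1 G) (hR : 0 < R)
    (hb : ∀ x, |G x| ≤ R / 2) (hε : 0 < ε) :
    ∫⁻ x, ENNReal.ofReal ‖fderiv ℝ (starCutoff R G ε) x‖ ≤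
      ∫⁻ ν : S2, ENNReal.ofReal ((R + G ν + ε) ^ 2 + 2 * (R + G ν + ε) * ‖fderiv ℝ G ν‖) ∂surf := by
  have hcont := (contDiff_starCutoff hG hR hb hε).continuous_fderiv (by simp)
  rw [lintegral_polar (by fun_prop)]
  refine lintegral_mono fun ν => ?_
  dsimp only
  set a := R + G ν with ha
  set L := ‖fderiv ℝ G ν‖
  have hapos : 0 < a := by have := neg_le_of_abs_le (hb ν); linarith
  have hL : 0 ≤ L := norm_nonneg _
  have h1 : ∀ s ∈ Ioi (0 : ℝ), ENNReal.ofReal (s ^ 2) *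
      ENNReal.ofReal ‖fderiv ℝ (starCutoff R G ε) (s • (ν : E3))‖ ≤
      (Icc a (a + ε)).indicator (fun s => ENNReal.ofReal ((a + ε) ^ 2 + 2 * (a + ε) * L) *
        ENNReal.ofReal (deriv Real.smoothTransition ((s - a) / ε) / ε)) s := by
    intro s hs
    have hs : (0 : ℝ) < s := hs
    have hle := norm_fderiv_starCutoff_smul_le (R := R) hG hε ν hs
    rw [← ha] at hle
    by_cases hmem : s ∈ Icc a (a + ε)
    · rw [indicator_of_mem hmem, ← ENNReal.ofReal_mul (by positivity),
        ← ENNReal.ofReal_mul (by positivity)]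
      apply ENNReal.ofReal_le_ofReal
      have hd := div_nonneg (deriv_smoothTransition_nonneg ((s - a) / ε)) hε.le
      calc _ ≤ s ^ 2 * (deriv Real.smoothTransition ((s - a) / ε) / ε * (1 + 2 * L / s)) := by
            gcongr
        _ = (s ^ 2 + 2 * s * L) * (deriv Real.smoothTransition ((s - a) / ε) / ε) := by
            field_simp
        _ ≤ _ := by
            have := hmem.2
            gcongr
    · have : (s - a) / ε ∉ Icc (0 : ℝ) 1 := by
        intro h
        apply hmem
        have h2 := h.1
        have h3 := h.2
        rw [div_le_one hε] at h3
        rw [le_div_iff₀ hε] at h2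
        constructor <;> linarith
      rw [deriv_smoothTransition_eq_zero this, zero_div, zero_mul] at hle
      rw [le_antisymm hle (norm_nonneg _)]
      simp
  have hm : Measurable fun s => ENNReal.ofReal (deriv Real.smoothTransition ((s - a) / ε) / ε) :=
    ((continuous_deriv_smoothTransition.measurable.comp (by fun_prop)).div_const ε).ennreal_ofReal
  calc _ ≤ ∫⁻ s in Ioi (0 : ℝ), (Icc a (a + ε)).indicator (fun s =>
        ENNReal.ofReal ((a + ε) ^ 2 + 2 * (a + ε) * L) *
        ENNReal.ofReal (deriv Real.smoothTransition ((s - a) / ε) / ε)) s :=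
        setLIntegral_mono ((hm.const_mul _).indicator measurableSet_Icc) h1
    _ ≤ ∫⁻ s, (Icc a (a + ε)).indicator (fun s =>
        ENNReal.ofReal ((a + ε) ^ 2 + 2 * (a + ε) * L) *
        ENNReal.ofReal (deriv Real.smoothTransition ((s - a) / ε) / ε)) s :=
        setLIntegral_le_lintegral _ _
    _ = _ := by
      rw [lintegral_indicator measurableSet_Icc, lintegral_const_mul _ hm,
        lintegral_deriv_smoothTransition a hε, mul_one]

theorem tendsto_starCutoff {R : ℝ} {G : E3 → ℝ} (hR : 0 < R) (hb : ∀ x, |G x| ≤ R / 2)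
    {u : ℕ → ℝ} (hu : ∀ k, 0 < u k) (hu0 : Tendsto u atTop (𝓝 0)) (x : E3) :
    Tendsto (fun k => starCutoff R G (u k) x) atTop
      (𝓝 ((starSet R (fun ν => G ν)).indicator (fun _ => 1) x)) := by
  rcases eq_or_ne x 0 with rfl | hx
  · rw [indicator_of_mem (zero_mem_starSet _ _)]
    have : ∀ k, starCutoff R G (u k) 0 = 1 := fun k =>
      (starCutoff_eventuallyEq_one hR hb (hu k)).eq_of_nhds
    simp [this]
  by_cases h : radialExcess R G x ≤ 0
  · rw [indicator_of_mem ((mem_starSet_iff hx).2 h)]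
    have : ∀ k, starCutoff R G (u k) x = 1 := fun k => by
      rw [starCutoff, Real.smoothTransition.zero_of_nonpos
        (div_nonpos_of_nonpos_of_nonneg h (hu k).le), sub_zero]
    simp [this]
  · rw [indicator_of_notMem (fun h' => h ((mem_starSet_iff hx).1 h'))]
    refine tendsto_const_nhds.congr' ?_
    filter_upwards [hu0.eventually (gt_mem_nhds (not_le.1 h))] with k hk
    rw [starCutoff, Real.smoothTransition.one_of_one_le, sub_self]
    rw [le_div_iff₀ (hu k)]; linarith

end

theorem continuous_divergence {F : E3 → E3} (hF : ContDiff ℝ 1 F) : Continuous (divergence F) := by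
  have := hF.continuous_fderiv (by simp)
  unfold divergence
  fun_prop

theorem hasCompactSupport_divergence {F : E3 → E3} (hF : HasCompactSupport F) :
    HasCompactSupport (divergence F) := by
  refine (hF.fderiv (𝕜 := ℝ)).mono' ?_
  refine Function.support_subset_iff'.2 fun x hx => ?_
  have : fderiv ℝ F x = 0 := by
    by_contra h
    exact hx (subset_tsupport _ h)
  simp [divergence, this]

theorem integral_mul_divergence {u : E3 → ℝ} {F : E3 → E3} (hu : ContDiff ℝ 1 u)
    (hF : ContDiff ℝ 1 F) (hFc : HasCompactSupport F) :
    ∫ x, u x * divergence F x = -∫ x, fderiv ℝ u x (F x) := by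
  have hFd := hF.continuous_fderiv (by simp)
  have hud := hu.continuous_fderiv (by simp)
  have hFcont := hF.continuous
  have hucont := hu.continuous
  have hcoord : ∀ (i : Fin 3) x, fderiv ℝ (fun y => F y i) x =
      (EuclideanSpace.proj i).comp (fderiv ℝ F x) := fun i x =>
    ((EuclideanSpace.proj i : E3 →L[ℝ] ℝ).hasFDerivAt.comp x
      (hF.differentiable (by simp) x).hasFDerivAt).fderiv
  have hcF : ∀ i : Fin 3, HasCompactSupport fun x => F x i := fun i =>
    hFc.comp_left (g := fun v : E3 => v i) rfl
  have hcD : ∀ i : Fin 3, HasCompactSupport fun x => fderiv ℝ F x (EuclideanSpace.single i 1) i :=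
    fun i => (hFc.fderiv (𝕜 := ℝ)).comp_left (g := fun A : E3 →L[ℝ] E3 =>
      A (EuclideanSpace.single i 1) i) rfl
  have hi1 : ∀ i : Fin 3, Integrable fun x => u x * fderiv ℝ F x (EuclideanSpace.single i 1) i :=
    fun i => Continuous.integrable_of_hasCompactSupport (by fun_prop) (hcD i).mul_left
  have hi2 : ∀ i : Fin 3, Integrable fun x => fderiv ℝ u x (EuclideanSpace.single i 1) * F x i :=
    fun i => Continuous.integrable_of_hasCompactSupport (by fun_prop) (hcF i).mul_left
  have hi3 : ∀ i : Fin 3, Integrable fun x => u x * F x i :=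
    fun i => Continuous.integrable_of_hasCompactSupport (by fun_prop) (hcF i).mul_left
  have h1 : ∀ i : Fin 3, ∫ x, u x * fderiv ℝ F x (EuclideanSpace.single i 1) i =
      -∫ x, fderiv ℝ u x (EuclideanSpace.single i 1) * F x i := by
    intro i
    have := integral_mul_fderiv_eq_neg_fderiv_mul_of_integrable (μ := (volume : Measure E3))
      (f := u) (g := fun x => F x i) (v := EuclideanSpace.single i 1) (hi2 i)
      (by simpa only [hcoord] using! hi1 i) (hi3 i)
      (fun x _ => hu.differentiable (by simp) x)
      (fun x _ => ((EuclideanSpace.proj i : E3 →L[ℝ] ℝ).hasFDerivAt.comp x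
        (hF.differentiable (by simp) x).hasFDerivAt).differentiableAt)
    simpa only [hcoord] using! this
  have h2 : ∀ x, fderiv ℝ u x (F x) =
      ∑ i : Fin 3, fderiv ℝ u x (EuclideanSpace.single i 1) * F x i := by
    intro x
    have : F x = ∑ i : Fin 3, F x i • (EuclideanSpace.single i 1 : E3) := by
      have := (EuclideanSpace.basisFun (Fin 3) ℝ).sum_repr (F x)
      simpa using this.symm
    conv_lhs => rw [this]
    simp [mul_comm]
  simp only [h2, divergence, Finset.mul_sum]
  rw [integral_finsetSum _ fun i _ => hi1 i, integral_finsetSum _ fun i _ => hi2 i]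
  simp [h1]

/-- The surface area of a star-shaped graph bounds its perimeter. -/
theorem perimeter_starSet_le {R L : ℝ} {G : E3 → ℝ} (hG : ContDiff ℝ 1 G) (hR : 0 < R)
    (hb : ∀ x, |G x| ≤ R / 2) (hL : ∀ ν : S2, ‖fderiv ℝ G ν‖ ≤ L) :
    perimeter (starSet R (fun ν => G ν)) ≤
      ∫⁻ ν : S2, ENNReal.ofReal ((R + G ν) ^ 2 + 2 * (R + G ν) * ‖fderiv ℝ G ν‖) ∂surf := by
  refine iSup_le fun F => iSup_le fun hF => iSup_le fun hFc => iSup_le fun hF1 => ?_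
  set I := ∫⁻ ν : S2, ENNReal.ofReal ((R + G ν) ^ 2 + 2 * (R + G ν) * ‖fderiv ℝ G ν‖) ∂surf
  set Ω := starSet R (fun ν => G ν)
  have hΩ : MeasurableSet Ω := measurableSet_starSet R hG.continuous
  set u : ℕ → ℝ := fun k => 1 / ((k : ℝ) + 1)
  have hu : ∀ k, 0 < u k := fun k => Nat.one_div_pos_of_nat
  have hu1 : ∀ k, u k ≤ 1 := fun k => by
    simp only [u]; rw [div_le_one (by positivity)]; linarith [(Nat.cast_nonneg k : (0 : ℝ) ≤ k)]
  have hu0 : Tendsto u atTop (𝓝 0) := tendsto_one_div_add_atTop_nhds_zero_nat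
  have hdc := continuous_divergence hF
  -- The cutoffs decrease the problem to smooth weights: integration by parts then bounds each term
  -- of the sequence by the total gradient of the cutoff, since `‖F x‖ ≤ 1`.
  have hlim : Tendsto (fun k => ∫ x, starCutoff R G (u k) x * divergence F x) atTop
      (𝓝 (∫ x in Ω, divergence F x)) := by
    rw [← integral_indicator hΩ]
    refine tendsto_integral_of_dominated_convergence (fun x => ‖divergence F x‖) ?_
      (hdc.integrable_of_hasCompactSupport (hasCompactSupport_divergence hFc)).norm ?_ ?_
    · intro k
      have := (contDiff_starCutoff hG hR hb (hu k)).continuous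
      fun_prop
    · refine fun k => Filter.Eventually.of_forall fun x => ?_
      rw [norm_mul]
      refine mul_le_of_le_one_left (norm_nonneg _) ?_
      rw [Real.norm_eq_abs, abs_le, starCutoff]
      constructor <;> linarith [Real.smoothTransition.le_one (radialExcess R G x / u k),
        Real.smoothTransition.nonneg (radialExcess R G x / u k)]
    · refine Filter.Eventually.of_forall fun x => ?_
      have := (tendsto_starCutoff hR hb hu hu0 x).mul_const (divergence F x)
      convert this using 2
      by_cases hx : x ∈ Ω <;> simp [hx, Ω]
  -- With `a = R + G ν ≤ 3 * R / 2` and `ε ≤ 1`, replacing `a` by `a + ε` adds `2 * a * ε + ε ^ 2 +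
  -- 2 * ε * L`, which is at most `K * ε`.
  set K := 4 * R + 1 + 2 * L
  have hL0 : 0 ≤ L := (norm_nonneg _).trans (hL ⟨EuclideanSpace.single 0 1, by simp⟩)
  have hK : 0 ≤ K := by positivity
  have hbound : ∀ k, ENNReal.ofReal (∫ x, starCutoff R G (u k) x * divergence F x) ≤
      I + ENNReal.ofReal (K * u k * (4 * Real.pi)) := by
    intro k
    have hcd := contDiff_starCutoff hG hR hb (hu k)
    have hcont := hcd.continuous_fderiv (by simp)
    have hFcont := hF.continuous
    rw [integral_mul_divergence hcd hF hFc]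
    have hint : Integrable fun x => ‖fderiv ℝ (starCutoff R G (u k)) x‖ :=
      (hcont.norm.integrable_of_hasCompactSupport
        ((hasCompactSupport_starCutoff hb (hu k)).fderiv (𝕜 := ℝ)).norm)
    calc _ ≤ ENNReal.ofReal (∫ x, ‖fderiv ℝ (starCutoff R G (u k)) x‖) := by
          apply ENNReal.ofReal_le_ofReal
          rw [← integral_neg]
          have hi : Integrable fun x => -(fderiv ℝ (starCutoff R G (u k)) x (F x)) :=
            ((hcont.clm_apply hFcont).neg).integrable_of_hasCompactSupport
              (hFc.mono' ((Function.support_subset_iff'.2 fun x hx => by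
                simp [image_eq_zero_of_notMem_tsupport hx])))
          refine integral_mono hi hint fun x => ?_
          have h1 := (fderiv ℝ (starCutoff R G (u k)) x).le_opNorm (F x)
          have h2 := mul_le_of_le_one_right
            (norm_nonneg (fderiv ℝ (starCutoff R G (u k)) x)) (hF1 x)
          exact (neg_le_abs _).trans (h1.trans h2)
      _ = ∫⁻ x, ENNReal.ofReal ‖fderiv ℝ (starCutoff R G (u k)) x‖ :=
          ofReal_integral_eq_lintegral_ofReal hint
            (Filter.Eventually.of_forall fun x => norm_nonneg _)
      _ ≤ _ := lintegral_norm_fderiv_starCutoff_le hG hR hb (hu k)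
      _ ≤ ∫⁻ ν : S2, (ENNReal.ofReal ((R + G ν) ^ 2 + 2 * (R + G ν) * ‖fderiv ℝ G ν‖) +
          ENNReal.ofReal (K * u k)) ∂surf := by
          refine lintegral_mono fun ν => ?_
          have h1 := abs_le.1 (hb ν)
          have h2 : 0 ≤ R + G ν := by linarith
          have h3 := hu k
          dsimp only
          rw [← ENNReal.ofReal_add (by positivity) (by positivity)]
          apply ENNReal.ofReal_le_ofReal
          have h4 := mul_le_mul_of_nonneg_left (hL ν) (hu k).le
          have h5 : (R + G ν) * u k ≤ (3 / 2 * R) * u k := by gcongr; linarith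
          have h6 : u k * u k ≤ 1 * u k := by gcongr; exact hu1 k
          have h7 : 0 ≤ R * u k := by positivity
          simp only [K]
          nlinarith
      _ = _ := by
          rw [lintegral_add_right _ measurable_const, lintegral_const, surf_univ,
            ENNReal.ofReal_mul (p := K * u k) (by have := hu k; positivity)]
  have hR' : Tendsto (fun k => I + ENNReal.ofReal (K * u k * (4 * Real.pi))) atTop
      (𝓝 (I + ENNReal.ofReal (K * 0 * (4 * Real.pi)))) :=
    tendsto_const_nhds.add (ENNReal.tendsto_ofReal ((hu0.const_mul K).mul_const _))
  have := le_of_tendsto_of_tendsto' (ENNReal.tendsto_ofReal hlim) hR' hbound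
  simpa using this

/-! ### Perimeter of the ball, from below. -/

/-- The field `2 R x / (R² + |x|²)`, of norm at most `1` and equal to the normal on `∂B_R`. -/
def normalField (R : ℝ) (x : E3) : E3 := (2 * R / (R ^ 2 + ‖x‖ ^ 2)) • x

theorem norm_normalField_le {R : ℝ} (hR : 0 < R) (x : E3) : ‖normalField R x‖ ≤ 1 := by
  rw [normalField, norm_smul, Real.norm_eq_abs, abs_of_pos (by positivity), div_mul_eq_mul_div,
    div_le_one (by positivity)]
  nlinarith [sq_nonneg (R - ‖x‖)]

theorem contDiff_normalField {R : ℝ} (hR : 0 < R) {n : WithTop ℕ∞} :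
    ContDiff ℝ n (normalField R) := by
  unfold normalField
  refine ContDiff.smul (ContDiff.div contDiff_const (contDiff_const.add (contDiff_norm_sq ℝ)) ?_)
    contDiff_id
  intro x; positivity

theorem divergence_normalField {R : ℝ} (hR : 0 < R) (x : E3) :
    divergence (normalField R) x =
      6 * R / (R ^ 2 + ‖x‖ ^ 2) - 4 * R * ‖x‖ ^ 2 / (R ^ 2 + ‖x‖ ^ 2) ^ 2 := by
  have hp : R ^ 2 + ‖x‖ ^ 2 ≠ 0 := by positivity
  have h1 : HasFDerivAt (fun x : E3 => R ^ 2 + ‖x‖ ^ 2) (2 • innerSL ℝ x) x :=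
    ((hasStrictFDerivAt_norm_sq x).hasFDerivAt).const_add _
  have h2 : HasFDerivAt (fun x : E3 => 2 * R / (R ^ 2 + ‖x‖ ^ 2))
      ((2 * R) • (-((R ^ 2 + ‖x‖ ^ 2) ^ 2)⁻¹ • ((2 : ℕ) • innerSL ℝ x))) x := by
    have := ((hasDerivAt_inv hp).comp_hasFDerivAt x h1).const_mul (2 * R)
    simpa only [div_eq_mul_inv] using! this
  have h3 : HasFDerivAt (normalField R) _ x := h2.smul (hasFDerivAt_id x)
  rw [divergence, h3.fderiv]
  have hn : ‖x‖ ^ 2 = x 0 * x 0 + x 1 * x 1 + x 2 * x 2 := by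
    rw [EuclideanSpace.norm_sq_eq, Fin.sum_univ_three]; simp [sq]
  simp only [Fin.sum_univ_three, add_apply, smul_apply,
    ContinuousLinearMap.id_apply, ContinuousLinearMap.smulRight_apply, innerSL_apply_apply,
    EuclideanSpace.inner_single_right, PiLp.add_apply, PiLp.smul_apply, smul_eq_mul, nsmul_eq_mul]
  simp
  rw [show 4 * R * ‖x‖ ^ 2 = 4 * R * (x 0 * x 0 + x 1 * x 1 + x 2 * x 2) by rw [hn]]
  ring

theorem divergence_eventuallyEq {F F' : E3 → E3} {x : E3} (h : F =ᶠ[𝓝 x] F') :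
    divergence F x = divergence F' x := by
  rw [divergence, divergence, h.fderiv_eq]

theorem surf_real_univ :
    (Module.finrank ℝ E3 : ℝ) * (volume : Measure E3).real (Metric.ball 0 1) = 4 * Real.pi := by
  rw [← Measure.toSphere_real_apply_univ, Measure.real]
  have := surf_univ
  rw [surf] at this
  rw [this, ENNReal.toReal_ofReal (by positivity)]

theorem integral_closedBall_divergence_normalField {R : ℝ} (hR : 0 < R) :
    ∫ x in Metric.closedBall (0 : E3) R, divergence (normalField R) x = 4 * Real.pi * R ^ 2 := by
  set f : ℝ → ℝ := fun s => 6 * R / (R ^ 2 + s ^ 2) - 4 * R * s ^ 2 / (R ^ 2 + s ^ 2) ^ 2 with hf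
  have hpos : ∀ s : ℝ, R ^ 2 + s ^ 2 ≠ 0 := fun s => by positivity
  have h1 : ∫ x in Metric.closedBall (0 : E3) R, divergence (normalField R) x =
      ∫ x : E3, (Iic R).indicator f ‖x‖ := by
    rw [← integral_indicator Metric.isClosed_closedBall.measurableSet]
    refine integral_congr_ae (Filter.Eventually.of_forall fun x => ?_)
    simp only [indicator, divergence_normalField hR, Metric.mem_closedBall, dist_zero_right,
      mem_Iic, hf]
  have h2 : ∫ y in Ioi (0 : ℝ), y ^ (Module.finrank ℝ E3 - 1) • (Iic R).indicator f y =
      ∫ y in (0 : ℝ)..R, y ^ 2 * f y := by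
    rw [intervalIntegral.integral_of_le hR.le, ← integral_indicator measurableSet_Ioi,
      ← integral_indicator measurableSet_Ioc]
    refine integral_congr_ae (Filter.Eventually.of_forall fun y => ?_)
    have : Module.finrank ℝ E3 - 1 = 2 := by simp
    simp only [this, indicator, mem_Ioi, mem_Iic, mem_Ioc, smul_eq_mul]
    split_ifs <;> simp_all
  -- The antiderivative is `s ^ 2` times the radial component of the field, that is, its flux
  -- through the sphere of radius `s` up to `4 * π`.
  have h3 : ∀ s : ℝ, HasDerivAt (fun s : ℝ => s ^ 3 * (2 * R) / (R ^ 2 + s ^ 2)) (s ^ 2 * f s) s := by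
    intro s
    have a1 : HasDerivAt (fun s : ℝ => s ^ 3 * (2 * R)) (3 * s ^ 2 * (2 * R)) s := by
      simpa using (hasDerivAt_pow 3 s).mul_const (2 * R)
    have a2 : HasDerivAt (fun s : ℝ => R ^ 2 + s ^ 2) (2 * s) s := by
      simpa using (hasDerivAt_pow 2 s).const_add (R ^ 2)
    refine (a1.div a2 (hpos s)).congr_deriv ?_
    simp only [hf]
    have := hpos s
    field_simp
    ring
  have hcont : Continuous fun s => s ^ 2 * f s := by
    simp only [hf]
    refine (continuous_pow 2).mul (Continuous.sub ?_ ?_)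
    · exact Continuous.div (by fun_prop) (by fun_prop) hpos
    · exact Continuous.div (by fun_prop) (by fun_prop) fun s => pow_ne_zero 2 (hpos s)
  rw [h1, integral_fun_norm_addHaar, h2, intervalIntegral.integral_eq_sub_of_hasDerivAt
    (fun s _ => h3 s) (hcont.intervalIntegrable _ _), nsmul_eq_mul, smul_eq_mul, ← mul_assoc,
    surf_real_univ]
  field_simp
  ring

theorem le_perimeter_closedBall {R : ℝ} (hR : 0 < R) :
    ENNReal.ofReal (4 * Real.pi * R ^ 2) ≤ perimeter (Metric.closedBall (0 : E3) R) := by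
  -- The normal field lacks compact support. The bump equals `1` on a neighbourhood of the closed
  -- ball, so multiplying by it leaves the divergence there unchanged.
  let χ : ContDiffBump (0 : E3) := ⟨2 * R, 3 * R, by positivity, by linarith⟩
  set F : E3 → E3 := fun x => χ x • normalField R x
  have hF : ContDiff ℝ 1 F := χ.contDiff.smul (contDiff_normalField hR)
  have hFc : HasCompactSupport F := χ.hasCompactSupport.smul_right
  have hF1 : ∀ x, ‖F x‖ ≤ 1 := by
    intro x
    rw [norm_smul, Real.norm_eq_abs, abs_of_nonneg χ.nonneg]
    exact mul_le_one₀ χ.le_one (norm_nonneg _) (norm_normalField_le hR x)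
  have h : ∫ x in Metric.closedBall (0 : E3) R, divergence F x = 4 * Real.pi * R ^ 2 := by
    rw [← integral_closedBall_divergence_normalField hR]
    refine setIntegral_congr_fun Metric.isClosed_closedBall.measurableSet fun x hx => ?_
    refine divergence_eventuallyEq ?_
    have hx' : x ∈ Metric.ball (0 : E3) χ.rIn := by
      rw [Metric.mem_closedBall] at hx
      rw [Metric.mem_ball]
      exact hx.trans_lt (by show R < 2 * R; linarith)
    filter_upwards [χ.eventuallyEq_one_of_mem_ball hx'] with y hy
    simp [F, hy]
  rw [← h]
  exact le_iSup_of_le F (le_iSup_of_le hF (le_iSup_of_le hFc (le_iSup_of_le hF1 le_rfl)))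

/-! ### Volume of radial graphs and area of caps. -/

theorem lintegral_sq_Ioc {a : ℝ} (ha : 0 ≤ a) :
    ∫⁻ s in Ioc 0 a, ENNReal.ofReal (s ^ 2) = ENNReal.ofReal (a ^ 3 / 3) := by
  rw [← ofReal_integral_eq_lintegral_ofReal ((continuous_pow 2).integrableOn_Ioc)
    (Filter.Eventually.of_forall fun s => sq_nonneg s), ← intervalIntegral.integral_of_le ha,
    integral_pow]
  norm_num

theorem volume_starSet {R : ℝ} {G : E3 → ℝ} (hG : Continuous G) (hb : ∀ ν : S2, 0 ≤ R + G ν) :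
    volume (starSet R (fun ν => G ν)) = ∫⁻ ν : S2, ENNReal.ofReal ((R + G ν) ^ 3 / 3) ∂surf := by
  have hΩ := measurableSet_starSet R hG
  rw [← lintegral_indicator_one hΩ, lintegral_polar (measurable_one.indicator hΩ)]
  refine lintegral_congr fun ν => ?_
  rw [← lintegral_sq_Ioc (hb ν), ← lintegral_indicator measurableSet_Ioi,
    ← lintegral_indicator measurableSet_Ioc]
  refine lintegral_congr fun s => ?_
  by_cases hs : 0 < s
  · rw [indicator_of_mem (mem_Ioi.2 hs)]
    have hx : s • (ν : E3) ≠ 0 := by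
      rw [← norm_pos_iff, norm_smul, Real.norm_eq_abs, abs_of_pos hs]; simpa using hs
    by_cases h : s ≤ R + G ν
    · rw [indicator_of_mem (mem_Ioc.2 ⟨hs, h⟩), indicator_of_mem]
      · simp
      · rw [mem_starSet_iff hx, radialExcess_smul ν hs]; linarith
    · have h1 : s ∉ Ioc 0 (R + G ν) := fun h' => h h'.2
      have h2 : s • (ν : E3) ∉ starSet R (fun ν => G ν) := by
        rw [mem_starSet_iff hx, radialExcess_smul ν hs]; intro h'; apply h; linarith
      rw [indicator_of_notMem h1, indicator_of_notMem h2, mul_zero]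
  · rw [indicator_of_notMem (by simpa using hs), indicator_of_notMem (fun h' => hs h'.1)]

/-- For unit vectors, chord at most `τ` means inner product at least `1 - τ ^ 2 / 2`; the hat-box
theorem gives such a cap area at most `2 * π * (τ ^ 2 / 2)`. -/
theorem surf_cap_le (ν₀ : S2) {τ : ℝ} (hτ : 0 ≤ τ) :
    surf {ν : S2 | ‖(ν : E3) - ν₀‖ ≤ τ} ≤ ENNReal.ofReal (Real.pi * τ ^ 2) := by
  have hm : MeasurableSet {ν : S2 | ‖(ν : E3) - ν₀‖ ≤ τ} :=
    measurableSet_le (by fun_prop) measurable_const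
  have h1 : surf {ν : S2 | ‖(ν : E3) - ν₀‖ ≤ τ} =
      ∫⁻ ν : S2, (Ici (1 - τ ^ 2 / 2)).indicator 1 (inner ℝ (ν₀ : E3) (ν : E3)) ∂surf := by
    rw [← lintegral_indicator_one hm]
    refine lintegral_congr fun ν => ?_
    have h2 : ‖(ν : E3) - ν₀‖ ≤ τ ↔ 1 - τ ^ 2 / 2 ≤ inner ℝ (ν₀ : E3) (ν : E3) := by
      rw [← sq_le_sq₀ (norm_nonneg _) hτ, norm_sub_sq_real, real_inner_comm]
      simp only [norm_eq_of_mem_sphere]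
      constructor <;> intro h <;> linarith
    simp only [indicator, mem_ofPred_eq, h2, mem_Ici, Pi.one_apply]
  rw [h1, lintegral_surf_inner (measurable_one.indicator measurableSet_Ici),
    lintegral_indicator_one measurableSet_Ici, Measure.restrict_apply measurableSet_Ici]
  calc _ ≤ ENNReal.ofReal (2 * Real.pi) * volume (Icc (1 - τ ^ 2 / 2) 1) := by
        gcongr
        intro t ht
        exact ⟨ht.1, ht.2.2.le⟩
    _ = _ := by
        rw [Real.volume_Icc, ← ENNReal.ofReal_mul (by positivity)]
        congr 1; ring

/-! ### The spike and the dent. -/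

/-- A fixed smooth bump function on `ℝ³`. -/
def bumpProfile : ContDiffBump (0 : E3) := ⟨1, 2, one_pos, one_lt_two⟩

/-- The bump function of width `τ` around `a`. -/
def scaledBump (a : E3) (τ : ℝ) (x : E3) : ℝ := bumpProfile (τ⁻¹ • (x - a))

theorem contDiff_scaledBump (a : E3) (τ : ℝ) : ContDiff ℝ ∞ (scaledBump a τ) := by
  have h : ContDiff ℝ ∞ fun x : E3 => τ⁻¹ • (x - a) := by fun_prop
  exact bumpProfile.contDiff.comp h

theorem continuous_scaledBump (a : E3) (τ : ℝ) : Continuous (scaledBump a τ) :=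
  (contDiff_scaledBump a τ).continuous

theorem scaledBump_nonneg (a : E3) (τ : ℝ) (x : E3) : 0 ≤ scaledBump a τ x := bumpProfile.nonneg

theorem scaledBump_le_one (a : E3) (τ : ℝ) (x : E3) : scaledBump a τ x ≤ 1 := bumpProfile.le_one

theorem norm_inv_smul_sub {a x : E3} {τ : ℝ} (hτ : 0 < τ) :
    ‖τ⁻¹ • (x - a)‖ = ‖x - a‖ / τ := by
  rw [norm_smul, norm_inv, Real.norm_eq_abs, abs_of_pos hτ, div_eq_inv_mul]

theorem scaledBump_eq_one {a x : E3} {τ : ℝ} (hτ : 0 < τ) (h : ‖x - a‖ ≤ τ) :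
    scaledBump a τ x = 1 := by
  refine bumpProfile.one_of_mem_closedBall ?_
  rw [mem_closedBall_zero_iff, norm_inv_smul_sub hτ]
  show _ ≤ (1 : ℝ)
  rwa [div_le_one hτ]

theorem scaledBump_eq_zero {a x : E3} {τ : ℝ} (hτ : 0 < τ) (h : 2 * τ ≤ ‖x - a‖) :
    scaledBump a τ x = 0 := by
  refine bumpProfile.zero_of_le_dist ?_
  rw [dist_zero_right, norm_inv_smul_sub hτ]
  show (2 : ℝ) ≤ _
  rwa [le_div_iff₀ hτ]

/-- One constant serves all centres and widths, by scaling. The indicator ensures that the steep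
slope of a narrow spike is charged only to a small cap. -/
theorem exists_norm_fderiv_scaledBump_le :
    ∃ M : ℝ, 0 ≤ M ∧ ∀ (a : E3) (τ : ℝ), 0 < τ → ∀ x,
      ‖fderiv ℝ (scaledBump a τ) x‖ ≤ (Metric.closedBall a (2 * τ)).indicator (fun _ => M / τ) x := by
  have hc : ContDiff ℝ 1 (bumpProfile : E3 → ℝ) := bumpProfile.contDiff
  obtain ⟨M, hM⟩ := (bumpProfile.hasCompactSupport.fderiv (𝕜 := ℝ)).exists_bound_of_continuous
    (hc.continuous_fderiv (by simp))
  have hM0 : 0 ≤ M := (norm_nonneg _).trans (hM 0)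
  refine ⟨M, hM0, fun a τ hτ x => ?_⟩
  by_cases hx : x ∈ Metric.closedBall a (2 * τ)
  · rw [indicator_of_mem hx]
    have h1 : HasFDerivAt (fun x : E3 => τ⁻¹ • (x - a)) (τ⁻¹ • ContinuousLinearMap.id ℝ E3) x :=
      ((hasFDerivAt_id x).sub_const a).const_smul τ⁻¹
    have h2 : HasFDerivAt (scaledBump a τ) _ x :=
      (hc.differentiable (by simp) (τ⁻¹ • (x - a))).hasFDerivAt.comp x h1
    rw [h2.fderiv]
    refine (ContinuousLinearMap.opNorm_comp_le _ _).trans ?_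
    rw [norm_smul, norm_inv, Real.norm_eq_abs, abs_of_pos hτ, div_eq_mul_inv]
    calc _ ≤ M * (τ⁻¹ * 1) := by
          gcongr
          · exact hM _
          · exact ContinuousLinearMap.norm_id_le
      _ = _ := by ring
  · rw [indicator_of_notMem hx]
    have : scaledBump a τ =ᶠ[𝓝 x] fun _ => 0 := by
      have ho : IsOpen {y : E3 | 2 * τ < ‖y - a‖} := isOpen_lt continuous_const (by fun_prop)
      rw [mem_closedBall_iff_norm, not_le] at hx
      filter_upwards [ho.mem_nhds hx] with y hy
      exact scaledBump_eq_zero hτ (le_of_lt hy)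
    rw [this.fderiv_eq]
    simp

/-- A spike of height `A` and width `r`, together with a dent of depth `t` and width `κ`. -/
def spikeProfile (a : E3) (A r t κ : ℝ) (x : E3) : ℝ :=
  A * scaledBump a r x - t * scaledBump a κ x

section

variable {a : E3} {A r t κ : ℝ}

theorem contDiff_spikeProfile : ContDiff ℝ ∞ (spikeProfile a A r t κ) :=
  (contDiff_const.mul (contDiff_scaledBump a r)).sub (contDiff_const.mul (contDiff_scaledBump a κ))

theorem spikeProfile_le (ht : 0 ≤ t) (x : E3) :
    spikeProfile a A r t κ x ≤ A * scaledBump a r x :=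
  sub_le_self _ (mul_nonneg ht (scaledBump_nonneg _ _ _))

theorem spikeProfile_le_height (hA : 0 ≤ A) (ht : 0 ≤ t) (x : E3) :
    spikeProfile a A r t κ x ≤ A :=
  (spikeProfile_le ht x).trans (mul_le_of_le_one_right hA (scaledBump_le_one _ _ _))

theorem neg_le_spikeProfile (hA : 0 ≤ A) (ht : 0 ≤ t) (x : E3) :
    -t ≤ spikeProfile a A r t κ x := by
  have h1 := mul_nonneg hA (scaledBump_nonneg a r x)
  have h2 := mul_le_of_le_one_right ht (scaledBump_le_one a κ x)
  rw [spikeProfile]; linarith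

theorem abs_spikeProfile_le (hA : 0 ≤ A) (ht : 0 ≤ t) (htA : t ≤ A) (x : E3) :
    |spikeProfile a A r t κ x| ≤ A := by
  rw [abs_le]
  constructor <;> linarith [neg_le_spikeProfile (a := a) (r := r) (κ := κ) hA ht x,
    spikeProfile_le_height (a := a) (r := r) (κ := κ) hA ht x]

theorem spikeProfile_eq_zero (hr : 0 < r) (hrκ : r ≤ κ) {x : E3} (hx : 2 * κ ≤ ‖x - a‖) :
    spikeProfile a A r t κ x = 0 := by
  rw [spikeProfile, scaledBump_eq_zero hr (by linarith),
    scaledBump_eq_zero (hr.trans_le hrκ) hx]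
  simp

theorem le_spikeProfile_of_near (hr : 0 < r) (ht : 0 ≤ t) {x : E3} (hx : ‖x - a‖ ≤ r) :
    A - t ≤ spikeProfile a A r t κ x := by
  rw [spikeProfile, scaledBump_eq_one hr hx, mul_one]
  have h2 := mul_le_of_le_one_right ht (scaledBump_le_one a κ x)
  linarith

end

/-! ### Volume balance between spike and dent. -/

theorem integrable_surf {f : S2 → ℝ} (hf : Continuous f) : Integrable f surf :=
  hf.integrable_of_hasCompactSupport (HasCompactSupport.of_compactSpace f)

theorem integral_scaledBump_le (ν₀ : S2) {r : ℝ} (hr : 0 < r) :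
    ∫ ν : S2, scaledBump ν₀ r ν ∂surf ≤ 4 * Real.pi * r ^ 2 := by
  have hc := continuous_scaledBump ν₀ r
  have hm : MeasurableSet {ν : S2 | ‖(ν : E3) - ν₀‖ ≤ 2 * r} :=
    measurableSet_le (by fun_prop) measurable_const
  have h1 := surf_cap_le ν₀ (τ := 2 * r) (by positivity)
  calc ∫ ν : S2, scaledBump ν₀ r ν ∂surf
      ≤ ∫ ν : S2, {ν : S2 | ‖(ν : E3) - ν₀‖ ≤ 2 * r}.indicator 1 ν ∂surf := by
        refine integral_mono (integrable_surf (by fun_prop))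
          ((integrable_const (1 : ℝ)).indicator hm) fun ν => ?_
        by_cases hν : ‖(ν : E3) - ν₀‖ ≤ 2 * r
        · have hν' : ν ∈ {ν : S2 | ‖(ν : E3) - ν₀‖ ≤ 2 * r} := hν
          rw [indicator_of_mem hν']; exact scaledBump_le_one _ _ _
        · have hν' : ν ∉ {ν : S2 | ‖(ν : E3) - ν₀‖ ≤ 2 * r} := hν
          rw [indicator_of_notMem hν']
          exact (scaledBump_eq_zero hr (not_le.1 hν).le).le
    _ = surf.real {ν : S2 | ‖(ν : E3) - ν₀‖ ≤ 2 * r} := integral_indicator_one hm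
    _ ≤ Real.pi * (2 * r) ^ 2 := ENNReal.toReal_le_of_le_ofReal (by positivity) h1
    _ = _ := by ring

theorem integral_scaledBump_pos (ν₀ : S2) {κ : ℝ} (hκ : 0 < κ) :
    0 < ∫ ν : S2, scaledBump ν₀ κ ν ∂surf := by
  have hc := continuous_scaledBump ν₀ κ
  have : surf.IsOpenPosMeasure := by unfold surf; infer_instance
  refine Continuous.integral_pos_of_hasCompactSupport_nonneg_nonzero (x := ν₀) (by fun_prop)
    (HasCompactSupport.of_compactSpace _) (fun ν => scaledBump_nonneg _ _ _) ?_
  rw [scaledBump_eq_one hκ (by simpa using hκ.le)]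
  exact one_ne_zero

theorem surf_real_univ_eq : surf.real univ = 4 * Real.pi := by
  rw [Measure.real, surf_univ, ENNReal.toReal_ofReal (by positivity)]

/-- The depth of the dent can be chosen to balance the volume of the spike. -/
theorem exists_dent_depth (ν₀ : S2) {R A κ r : ℝ} (hA : 0 ≤ A) (hAR : A ≤ R / 2)
    (hr : 0 < r)
    (hsmall : 20 * Real.pi * A / (∫ ν : S2, scaledBump ν₀ κ ν ∂surf) * r ^ 2 ≤ A)
    (hκ : 0 < κ) :
    ∃ t, 0 ≤ t ∧ t ≤ 20 * Real.pi * A / (∫ ν : S2, scaledBump ν₀ κ ν ∂surf) * r ^ 2 ∧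
      ∫ ν : S2, (R + spikeProfile ν₀ A r t κ ν) ^ 3 ∂surf = 4 * Real.pi * R ^ 3 := by
  have hs := continuous_scaledBump ν₀ r
  have hd := continuous_scaledBump ν₀ κ
  set d := ∫ ν : S2, scaledBump ν₀ κ ν ∂surf with hddef
  have hdpos : 0 < d := integral_scaledBump_pos ν₀ hκ
  -- The value at which the guaranteed loss `R ^ 2 * t₁ * d` of the dent equals the bound `5 * R ^ 2
  -- * A * (4 * π * r ^ 2)` for the gain of the spike. The depth is then found between `0` and `t₁`
  -- by the intermediate value theorem.
  set t₁ := 20 * Real.pi * A / d * r ^ 2 with ht₁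
  have ht₁0 : 0 ≤ t₁ := by positivity
  set v : ℝ → ℝ := fun t => ∫ ν : S2, (R + spikeProfile ν₀ A r t κ ν) ^ 3 ∂surf with hv
  have hcont : Continuous v := by
    have := continuous_parametric_integral_of_continuous (μ := surf) (s := univ)
      (f := fun t (ν : S2) => (R + spikeProfile ν₀ A r t κ ν) ^ 3) (by
        simp only [spikeProfile, Function.uncurry_def]; fun_prop) isCompact_univ
    simpa only [Measure.restrict_univ] using this
  have hconst : ∀ c : ℝ, ∫ _ : S2, c ∂surf = 4 * Real.pi * c := fun c => by
    rw [integral_const, surf_real_univ_eq, smul_eq_mul]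
  have h0 : 4 * Real.pi * R ^ 3 ≤ v 0 := by
    rw [← hconst]
    refine integral_mono (integrable_const _)
      (integrable_surf (by simp only [spikeProfile]; fun_prop)) fun ν => ?_
    have h1 := mul_nonneg hA (scaledBump_nonneg ν₀ r ν)
    have h2 : 0 ≤ R := by linarith
    simp only [spikeProfile]
    gcongr
    linarith
  have h1 : v t₁ ≤ 4 * Real.pi * R ^ 3 := by
    have hpt : ∀ ν : S2, (R + spikeProfile ν₀ A r t₁ κ ν) ^ 3 ≤
        R ^ 3 + 5 * R ^ 2 * A * scaledBump ν₀ r ν - R ^ 2 * t₁ * scaledBump ν₀ κ ν := by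
      intro ν
      have a0 := mul_nonneg hA (scaledBump_nonneg ν₀ r ν)
      have a1 := mul_le_of_le_one_right hA (scaledBump_le_one ν₀ r ν)
      have b0 := mul_nonneg ht₁0 (scaledBump_nonneg ν₀ κ ν)
      have b1 := mul_le_of_le_one_right ht₁0 (scaledBump_le_one ν₀ κ ν)
      -- For `|d| ≤ R / 2` the quotient `((R + d) ^ 3 - R ^ 3) / d = 3 * R ^ 2 + 3 * R * d + d ^ 2`
      -- lies between `R ^ 2` and `5 * R ^ 2`; this separates the contributions of spike and dent.
      have key : ∀ x y : ℝ, 0 ≤ x → x ≤ R / 2 → 0 ≤ y → y ≤ R / 2 →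
          (R + (x - y)) ^ 3 ≤ R ^ 3 + 5 * R ^ 2 * x - R ^ 2 * y := by
        intro x y hx hx' hy hy'
        have hR : 0 ≤ R := by linarith
        rcases le_total y x with h | h
        · have e1 : (x - y) * (3 * R ^ 2 + 3 * R * (x - y) + (x - y) ^ 2) ≤
              (x - y) * (5 * R ^ 2) := by
            apply mul_le_mul_of_nonneg_left _ (by linarith)
            nlinarith
          nlinarith [mul_nonneg (sq_nonneg R) hy]
        · have e1 : (y - x) * R ^ 2 ≤
              (y - x) * (3 * R ^ 2 + 3 * R * (x - y) + (x - y) ^ 2) := by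
            apply mul_le_mul_of_nonneg_left _ (by linarith)
            nlinarith
          nlinarith [mul_nonneg (sq_nonneg R) hx]
      have := key _ _ a0 (a1.trans hAR) b0 ((b1.trans hsmall).trans hAR)
      rw [spikeProfile]
      linarith
    have i1 : Integrable (fun ν : S2 => R ^ 3 + 5 * R ^ 2 * A * scaledBump ν₀ r ν) surf :=
      integrable_surf (by fun_prop)
    have i2 : Integrable (fun ν : S2 => R ^ 2 * t₁ * scaledBump ν₀ κ ν) surf :=
      integrable_surf (by fun_prop)
    calc v t₁ ≤ ∫ ν : S2, (R ^ 3 + 5 * R ^ 2 * A * scaledBump ν₀ r ν -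
          R ^ 2 * t₁ * scaledBump ν₀ κ ν) ∂surf :=
          integral_mono (integrable_surf (by simp only [spikeProfile]; fun_prop)) (i1.sub i2) hpt
      _ = 4 * Real.pi * R ^ 3 + 5 * R ^ 2 * A * (∫ ν : S2, scaledBump ν₀ r ν ∂surf) -
          R ^ 2 * t₁ * d := by
          rw [integral_sub i1 i2, integral_add (integrable_const _) (integrable_surf (by fun_prop)),
            hconst, integral_const_mul, integral_const_mul]
      _ ≤ 4 * Real.pi * R ^ 3 + 5 * R ^ 2 * A * (4 * Real.pi * r ^ 2) - R ^ 2 * t₁ * d := by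
          gcongr
          exact integral_scaledBump_le ν₀ hr
      _ = 4 * Real.pi * R ^ 3 := by
          rw [ht₁]; field_simp; ring
  obtain ⟨t, ht, hvt⟩ := intermediate_value_Icc' ht₁0 hcont.continuousOn ⟨h1, h0⟩
  exact ⟨t, ht.1, ht.2, hvt⟩

theorem volume_starSet_of_integral {R : ℝ} {G : E3 → ℝ} (hG : Continuous G)
    (hb : ∀ ν : S2, 0 ≤ R + G ν)
    (h : ∫ ν : S2, (R + G ν) ^ 3 ∂surf = 4 * Real.pi * R ^ 3) :
    volume (starSet R (fun ν => G ν)) = ENNReal.ofReal (4 / 3 * Real.pi * R ^ 3) := by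
  rw [volume_starSet hG hb, ← ofReal_integral_eq_lintegral_ofReal
    (integrable_surf (by fun_prop)) (Filter.Eventually.of_forall fun ν => by
      have := hb ν
      show 0 ≤ _
      positivity), integral_div, h]
  congr 1; ring

/-! ### Perimeter cost of the spike. -/

/-- The perimeter excess of a spike of width `r` is at most linear in `r`. -/
theorem exists_perimeter_spike_le (ν₀ : S2) {R A κ C : ℝ} (hR : 0 < R) (hA : 0 < A)
    (hAR : A ≤ R / 2) (hκ : 0 < κ) (hC : 0 ≤ C) :
    ∃ C₁, 0 ≤ C₁ ∧ ∀ r t : ℝ, 0 < r → r ≤ 1 → 0 ≤ t → t ≤ A → t ≤ C * r ^ 2 →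
      perimeter (starSet R (fun ν => spikeProfile ν₀ A r t κ ν)) ≤
        ENNReal.ofReal (4 * Real.pi * R ^ 2 + C₁ * r) := by
  obtain ⟨M, hM0, hM⟩ := exists_norm_fderiv_scaledBump_le
  -- The first summand is the slope `t * (M / κ)` of the dent over the whole sphere, with `t ≤ C * r
  -- ^ 2 ≤ C * r`. The second is the spike: height and slope terms `3 * R * A + 4 * R * (A * M / r)`
  -- times the cap area `4 * π * r ^ 2`.
  refine ⟨4 * Real.pi * (4 * R * (C * M / κ)) + 4 * Real.pi * (3 * R * A + 4 * R * A * M),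
    by positivity, fun r t hr hr1 ht htA htC => ?_⟩
  set G := spikeProfile ν₀ A r t κ with hGdef
  have hG1 : ContDiff ℝ 1 G := contDiff_spikeProfile.of_le (by simp)
  have hD : ∀ x, ‖fderiv ℝ G x‖ ≤
      (Metric.closedBall (ν₀ : E3) (2 * r)).indicator (fun _ => A * M / r) x + t * (M / κ) := by
    intro x
    have d1 : DifferentiableAt ℝ (scaledBump (ν₀ : E3) r) x :=
      (contDiff_scaledBump _ _).differentiable (by simp) x
    have d2 : DifferentiableAt ℝ (scaledBump (ν₀ : E3) κ) x :=
      (contDiff_scaledBump _ _).differentiable (by simp) x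
    have h3 : HasFDerivAt G (A • fderiv ℝ (scaledBump (ν₀ : E3) r) x -
        t • fderiv ℝ (scaledBump (ν₀ : E3) κ) x) x :=
      (d1.hasFDerivAt.const_mul A).sub (d2.hasFDerivAt.const_mul t)
    rw [h3.fderiv]
    refine (norm_sub_le _ _).trans ?_
    rw [norm_smul, norm_smul, Real.norm_eq_abs, Real.norm_eq_abs, abs_of_pos hA, abs_of_nonneg ht]
    refine add_le_add ?_ ?_
    · refine (mul_le_mul_of_nonneg_left (hM ν₀ r hr x) hA.le).trans (le_of_eq ?_)
      by_cases hx : x ∈ Metric.closedBall (ν₀ : E3) (2 * r)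
      · rw [indicator_of_mem hx, indicator_of_mem hx]; ring
      · rw [indicator_of_notMem hx, indicator_of_notMem hx, mul_zero]
    · gcongr
      exact (hM ν₀ κ hκ x).trans (indicator_le_self' (fun _ _ => by positivity) x)
  have hL : ∀ ν : S2, ‖fderiv ℝ G ν‖ ≤ A * M / r + t * (M / κ) := fun ν =>
    (hD ν).trans (by gcongr; exact indicator_le_self' (fun _ _ => by positivity) (ν : E3))
  have hb : ∀ x, |G x| ≤ R / 2 := fun x => (abs_spikeProfile_le hA.le ht htA x).trans hAR
  refine (perimeter_starSet_le hG1 hR hb hL).trans ?_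
  set P := R ^ 2 + 4 * R * (t * (M / κ)) with hP
  set S := 3 * R * A + 4 * R * (A * M / r) with hS
  have hm : MeasurableSet {ν : S2 | ‖(ν : E3) - ν₀‖ ≤ 2 * r} :=
    measurableSet_le (by fun_prop) measurable_const
  have hpt : ∀ ν : S2, ENNReal.ofReal ((R + G ν) ^ 2 + 2 * (R + G ν) * ‖fderiv ℝ G ν‖) ≤
      ENNReal.ofReal P + {ν : S2 | ‖(ν : E3) - ν₀‖ ≤ 2 * r}.indicator
        (fun _ => ENNReal.ofReal S) ν := by
    intro ν
    have h1 := abs_le.1 (hb ν)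
    have h2 : 0 ≤ R + G ν := by linarith
    have h3 : G ν ≤ A := spikeProfile_le_height hA.le ht _
    have hDν := hD ν
    by_cases hν : ‖(ν : E3) - ν₀‖ ≤ 2 * r
    · rw [indicator_of_mem (mem_closedBall_iff_norm.2 hν)] at hDν
      rw [indicator_of_mem (show ν ∈ {ν : S2 | ‖(ν : E3) - ν₀‖ ≤ 2 * r} from hν),
        ← ENNReal.ofReal_add (by positivity) (by positivity)]
      apply ENNReal.ofReal_le_ofReal
      have h4 : 2 * (R + G ν) * ‖fderiv ℝ G ν‖ ≤ 2 * (2 * R) * (A * M / r + t * (M / κ)) := by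
        gcongr; linarith
      have h5 : (R + G ν) ^ 2 ≤ (R + A) ^ 2 := by gcongr
      have h6 : A * A ≤ R / 2 * A := by gcongr
      nlinarith [mul_pos hR hA]
    · rw [indicator_of_notMem (mt mem_closedBall_iff_norm.1 hν)] at hDν
      rw [indicator_of_notMem (show ν ∉ {ν : S2 | ‖(ν : E3) - ν₀‖ ≤ 2 * r} from hν), add_zero]
      apply ENNReal.ofReal_le_ofReal
      have h3' : G ν ≤ 0 := by
        refine (spikeProfile_le ht _).trans (le_of_eq ?_)
        rw [scaledBump_eq_zero hr (not_le.1 hν).le, mul_zero]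
      have h4 : 2 * (R + G ν) * ‖fderiv ℝ G ν‖ ≤ 2 * (2 * R) * (0 + t * (M / κ)) := by
        gcongr; linarith
      have h5 : (R + G ν) ^ 2 ≤ R ^ 2 := by gcongr; linarith
      linarith
  calc _ ≤ ∫⁻ ν : S2, (ENNReal.ofReal P + {ν : S2 | ‖(ν : E3) - ν₀‖ ≤ 2 * r}.indicator
        (fun _ => ENNReal.ofReal S) ν) ∂surf := lintegral_mono hpt
    _ = ENNReal.ofReal P * ENNReal.ofReal (4 * Real.pi) +
        ENNReal.ofReal S * surf {ν : S2 | ‖(ν : E3) - ν₀‖ ≤ 2 * r} := by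
        rw [lintegral_add_left measurable_const, lintegral_const, surf_univ,
          lintegral_indicator_const hm]
    _ ≤ ENNReal.ofReal P * ENNReal.ofReal (4 * Real.pi) +
        ENNReal.ofReal S * ENNReal.ofReal (Real.pi * (2 * r) ^ 2) := by
        gcongr
        exact surf_cap_le ν₀ (by positivity)
    _ = ENNReal.ofReal (P * (4 * Real.pi) + S * (Real.pi * (2 * r) ^ 2)) := by
        rw [← ENNReal.ofReal_mul (by positivity), ← ENNReal.ofReal_mul (by positivity),
          ← ENNReal.ofReal_add (by positivity) (by positivity)]
    _ ≤ _ := by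
        apply ENNReal.ofReal_le_ofReal
        have hrr : r ^ 2 ≤ r := by nlinarith
        have e1 : P ≤ R ^ 2 + 4 * R * (C * r * (M / κ)) := by
          rw [hP]; gcongr; exact htC.trans (by gcongr)
        have e2 : S * (Real.pi * (2 * r) ^ 2) =
            4 * Real.pi * (3 * R * A * r ^ 2 + 4 * R * A * M * r) := by
          rw [hS]; field_simp; ring
        have e3 : 3 * R * A * r ^ 2 ≤ 3 * R * A * r := by gcongr
        rw [e2]
        calc _ ≤ (R ^ 2 + 4 * R * (C * r * (M / κ))) * (4 * Real.pi) +
              4 * Real.pi * (3 * R * A * r + 4 * R * A * M * r) := by gcongr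
          _ = _ := by ring

/-! ### Charge transfer and comparison of energies. -/

theorem eventually_lt_of_continuous {f : ℝ → ℝ} (hf : Continuous f) {b : ℝ} (h : f 0 < b) :
    ∀ᶠ r in 𝓝[>] (0 : ℝ), f r < b :=
  (hf.tendsto 0).mono_left nhdsWithin_le_nhds |>.eventually (gt_mem_nhds h)

/-- With `n` large and fixed, moving a charge of order `n r` to `n` spheres of radius of order `r`
gains more than any prescribed multiple of `r`. -/
theorem exists_charge_transfer {R D A K C : ℝ} (hR : 0 < R) (hD : R < D) (hA : 0 < A) :
    ∃ n : ℕ, 0 < n ∧ ∀ᶠ r in 𝓝[>] (0 : ℝ), ∀ t, 0 ≤ t → t ≤ C * r ^ 2 → t < R ∧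
      ∃ q, 0 ≤ q ∧ q ≤ 1 ∧ (1 - q) ^ 2 / (R - t) + 2 * (1 - q) * q / D +
        q ^ 2 * (1 / (n * (r * R / 4)) + 1 / (A / (4 * n))) + K * r < 1 / R := by
  have hD0 : 0 < D := hR.trans hD
  set g := 1 / R - 1 / D with hg
  have hg0 : 0 < g := sub_pos.2 (one_div_lt_one_div_of_lt hR hD)
  -- The net gain will be `n * (g ^ 2 * R / 4) * r`. It must exceed `K * r`, with a further `r` in
  -- reserve for the errors of second order.
  obtain ⟨n, hn⟩ := exists_nat_gt (max 0 ((K + 1) * 4 / (g ^ 2 * R)))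
  have hn0 : (0 : ℝ) < n := (le_max_left _ _).trans_lt hn
  have hnK : K + 1 < n * (g ^ 2 * R / 4) := by
    have := (le_max_right _ _).trans_lt hn
    rw [div_lt_iff₀ (by positivity)] at this
    linarith
  -- The charge `q = β * n * r` minimizes `-2 * q * g + 4 * q ^ 2 / (n * r * R)`; at the minimum the
  -- self-energy is `q * g`, half of the saving.
  set β := g * R / 4 with hβ
  have hβ0 : 0 < β := by positivity
  -- `W * r ^ 2` collects the second-order errors: the shrinking of the large sphere to radius `R -
  -- t`, the term `q ^ 2 / R`, and the mutual repulsion of the small spheres.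
  set W := 2 * C / R ^ 2 + (β * n) ^ 2 * (1 / R + 4 * n / A) with hW
  refine ⟨n, by exact_mod_cast hn0, ?_⟩
  filter_upwards [self_mem_nhdsWithin,
    eventually_lt_of_continuous (f := fun r => C * r ^ 2) (b := R / 2) (by fun_prop)
      (by simpa using hR),
    eventually_lt_of_continuous (f := fun r => β * n * r) (b := 1) (by fun_prop) (by simp),
    eventually_lt_of_continuous (f := fun r => W * r) (b := 1) (by fun_prop) (by simp)]
    with r hr h1 h2 h3 t ht htC
  have hr : (0 : ℝ) < r := hr
  have htR : t ≤ R / 2 := htC.trans h1.le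
  have hRt : 0 < R - t := by linarith
  refine ⟨by linarith, β * n * r, by positivity, h2.le, ?_⟩
  set q := β * n * r with hq
  have hq0 : 0 < q := by positivity
  have e1 : (1 - q) ^ 2 / (R - t) ≤ (1 - 2 * q + q ^ 2) / R + 2 * C * r ^ 2 / R ^ 2 := by
    have a1 : 1 / (R - t) ≤ 1 / R + 2 * t / R ^ 2 := by
      rw [div_add_div _ _ hR.ne' (by positivity), div_le_div_iff₀ hRt (by positivity)]
      nlinarith [mul_nonneg (mul_nonneg hR.le ht) (sub_nonneg.2 htR)]
    have a2 : (1 - q) ^ 2 ≤ 1 := by nlinarith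
    calc (1 - q) ^ 2 / (R - t) = (1 - q) ^ 2 * (1 / (R - t)) := by ring
      _ ≤ (1 - q) ^ 2 * (1 / R + 2 * t / R ^ 2) := by gcongr
      _ = (1 - q) ^ 2 / R + (1 - q) ^ 2 * (2 * t / R ^ 2) := by ring
      _ ≤ (1 - q) ^ 2 / R + 1 * (2 * (C * r ^ 2) / R ^ 2) := by gcongr
      _ = _ := by ring
  have e2 : 2 * (1 - q) * q / D ≤ 2 * q / D := by
    gcongr
    nlinarith
  have e3 : q ^ 2 * (1 / (n * (r * R / 4)) + 1 / (A / (4 * n))) =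
      4 * β ^ 2 * n * r / R + q ^ 2 * (4 * n / A) := by
    rw [hq]; field_simp
  have e4 : 4 * β ^ 2 * n * r / R = q * g := by
    rw [hq, hβ]; field_simp
  have e5 : 2 * q / D = 2 * q / R - 2 * q * g := by rw [hg]; ring
  have e6 : q * g = n * (g ^ 2 * R / 4) * r := by rw [hq, hβ]; ring
  have e7 : (K + 1) * r < q * g := by rw [e6]; gcongr
  have e8 : q ^ 2 / R + 2 * C * r ^ 2 / R ^ 2 + q ^ 2 * (4 * n / A) = W * r * r := by
    rw [hW, hq]; ring
  have e9 : W * r * r < 1 * r := by gcongr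
  rw [e3, e4]
  have e10 : (1 - 2 * q + q ^ 2) / R = 1 / R - 2 * q / R + q ^ 2 / R := by ring
  linarith

theorem sphere_subset_starSet {R t : ℝ} {G : E3 → ℝ} (hG : ∀ x, -t ≤ G x) :
    Metric.sphere (0 : E3) (R - t) ⊆ starSet R (fun ν => G ν) := by
  intro x hx hx0
  rw [mem_sphere_zero_iff_norm] at hx
  have := hG (direction x hx0)
  linarith

/-- A point `x` of the small sphere is within `r * R / 2` of the axis point `‖x‖ • ν₀`, and `‖x‖ ≥ R
/ 2`, so its direction is within `r` of `ν₀`. There the spike rises to at least `A - t`, and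
`hsmall` keeps `x` below that height. -/
theorem sphere_subset_spike (ν₀ : S2) {R A r t κ c : ℝ} (hR : 0 < R) (hr : 0 < r) (hr1 : r ≤ 1)
    (ht : 0 ≤ t) (hc : R ≤ c) (hcA : c ≤ R + A / 2) (hsmall : r * R / 4 + t ≤ A / 2) :
    Metric.sphere (c • (ν₀ : E3)) (r * R / 4) ⊆
      starSet R (fun ν => spikeProfile ν₀ A r t κ ν) := by
  intro x hx hx0
  rw [mem_sphere_iff_norm] at hx
  have hc0 : 0 < c := hR.trans_le hc
  have hcn : ‖c • (ν₀ : E3)‖ = c := by simp [norm_smul, abs_of_pos hc0]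
  have h1 : |‖x‖ - c| ≤ r * R / 4 := by
    rw [← hx]
    simpa only [hcn] using abs_norm_sub_norm_le x (c • (ν₀ : E3))
  have h1' := abs_le.1 h1
  have hxpos : 0 < ‖x‖ := norm_pos_iff.2 hx0
  have h2 : ‖x - ‖x‖ • (ν₀ : E3)‖ ≤ r * R / 2 := by
    have e : x - ‖x‖ • (ν₀ : E3) = (x - c • (ν₀ : E3)) - (‖x‖ - c) • (ν₀ : E3) := by
      rw [sub_smul]; abel
    rw [e]
    refine (norm_sub_le _ _).trans ?_
    rw [hx, norm_smul, norm_eq_of_mem_sphere, mul_one, Real.norm_eq_abs]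
    linarith
  have h3 : ‖((direction x hx0 : S2) : E3) - ν₀‖ ≤ r := by
    have e : ((direction x hx0 : S2) : E3) - ν₀ = ‖x‖⁻¹ • (x - ‖x‖ • (ν₀ : E3)) := by
      rw [smul_sub, inv_smul_smul₀ hxpos.ne']; rfl
    rw [e, norm_smul, norm_inv, norm_norm, inv_mul_le_iff₀ hxpos]
    have : R / 2 ≤ ‖x‖ := by nlinarith [h1'.1]
    nlinarith
  have h4 := le_spikeProfile_of_near (A := A) (κ := κ) hr ht h3
  linarith [h1'.2]

theorem energy_eq (σ ε₀ Q : ℝ) (Ω : Set E3) :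
    energy σ ε₀ Q Ω =
      ENNReal.ofReal σ * perimeter Ω + ENNReal.ofReal (Q ^ 2 / 2) * inverseCapacitance ε₀ Ω := by
  rw [energy, capacitance, div_eq_mul_inv, ENNReal.mul_inv (by simp) (by simp), inv_inv,
    ← mul_assoc, ENNReal.ofReal_div_of_pos two_pos, ENNReal.ofReal_ofNat, div_eq_mul_inv]

/-- A sufficiently thin volume-preserving spike has less energy than the ball. -/
theorem exists_spike_energy_lt (ν₀ : S2) {σ ε₀ Q R A κ : ℝ} (hσ : 0 < σ) (hε₀ : 0 < ε₀)
    (hQ : 0 < Q) (hR : 0 < R) (hA : 0 < A) (hAR : A ≤ R / 2) (hκ : 0 < κ) :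
    ∃ r t, 0 < r ∧ r ≤ κ ∧ 0 ≤ t ∧ t ≤ A ∧
      volume (starSet R (fun ν => spikeProfile ν₀ A r t κ ν)) =
        ENNReal.ofReal (4 / 3 * Real.pi * R ^ 3) ∧
      energy σ ε₀ Q (starSet R (fun ν => spikeProfile ν₀ A r t κ ν)) <
        energy σ ε₀ Q (Metric.closedBall 0 R) := by
  set C := 20 * Real.pi * A / (∫ ν : S2, scaledBump ν₀ κ ν ∂surf) with hCdef
  have hC : 0 ≤ C := by have := integral_scaledBump_pos ν₀ hκ; positivity
  obtain ⟨C₁, hC₁, hper⟩ := exists_perimeter_spike_le ν₀ hR hA hAR hκ hC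
  set k := 1 / (4 * Real.pi * ε₀) with hk
  have hk0 : 0 < k := by positivity
  -- The perimeter cost `σ * C₁ * r` expressed in units of the electrostatic factor `Q ^ 2 / 2 * k`.
  set K := σ * C₁ / (Q ^ 2 / 2 * k) with hK
  obtain ⟨n, hn, hev⟩ := exists_charge_transfer (R := R) (D := R + A / 4) (A := A) (K := K) hR
    (by linarith) hA
  have hsmall : ∀ᶠ r in 𝓝[>] (0 : ℝ), 0 < r ∧ r < 1 ∧ r < κ ∧ C * r ^ 2 < A ∧
      r * R / 4 + C * r ^ 2 < A / 2 := by
    filter_upwards [self_mem_nhdsWithin,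
      eventually_lt_of_continuous (f := fun r => r) (b := 1) (by fun_prop) (by simp),
      eventually_lt_of_continuous (f := fun r => r) (b := κ) (by fun_prop) hκ,
      eventually_lt_of_continuous (f := fun r => C * r ^ 2) (b := A) (by fun_prop)
        (by simpa using hA),
      eventually_lt_of_continuous (f := fun r => r * R / 4 + C * r ^ 2) (b := A / 2) (by fun_prop)
        (by simpa using hA)] with r h1 h2 h3 h4 h5
    exact ⟨h1, h2, h3, h4, h5⟩
  obtain ⟨r, ⟨hr, hr1, hrκ, hCA, hsm⟩, hch⟩ := (hsmall.and hev).exists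
  obtain ⟨t, ht, htC, hvol⟩ := exists_dent_depth ν₀ hA.le hAR hr hCA.le hκ
  rw [← hCdef] at htC
  have htA : t ≤ A := htC.trans hCA.le
  obtain ⟨htR, q, hq0, hq1, hq⟩ := hch t ht htC
  refine ⟨r, t, hr, hrκ.le, ht, htA, ?_, ?_⟩
  · refine volume_starSet_of_integral contDiff_spikeProfile.continuous (fun ν => ?_) hvol
    linarith [neg_le_spikeProfile (a := ν₀) (r := r) (κ := κ) hA.le ht (ν : E3)]
  set Ω := starSet R (fun ν => spikeProfile ν₀ A r t κ ν)
  have hn0 : (0 : ℝ) < n := by exact_mod_cast hn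
  -- The centres are equally spaced in the second quarter of the spike, from `R + A / 4` to below `R
  -- + A / 2`, hence `D = R + A / 4` and `m = A / (4 * n)`.
  set c : Fin n → ℝ := fun i => R + A / 4 + (i : ℝ) * (A / (4 * n)) with hc
  have hcn : ∀ i, ‖c i • (ν₀ : E3)‖ = c i := fun i => by
    have : 0 ≤ c i := by positivity
    simp [norm_smul, abs_of_nonneg this]
  have hcap := inverseCapacitance_le_of_spheres (Ω := Ω) (ρ := R - t) (r := r * R / 4)
    (D := R + A / 4) (m := A / (4 * n)) hε₀
    (measurableSet_starSet R contDiff_spikeProfile.continuous) (by linarith) (by positivity)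
    (by positivity) (by positivity) hq0 hq1 hn (fun i => c i • (ν₀ : E3))
    (sphere_subset_starSet (neg_le_spikeProfile hA.le ht))
    (fun i => by
      refine sphere_subset_spike ν₀ hR hr hr1.le ht ?_ ?_ (by linarith)
      · have : 0 ≤ (i : ℝ) * (A / (4 * n)) := by positivity
        simp only [hc]; linarith
      · have hi : (i : ℝ) ≤ n := by exact_mod_cast i.2.le
        have : (i : ℝ) * (A / (4 * n)) ≤ n * (A / (4 * n)) := by gcongr
        have e : n * (A / (4 * n)) = A / 4 := by field_simp
        simp only [hc]; linarith)
    (fun i => by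
      have : 0 ≤ (i : ℝ) * (A / (4 * n)) := by positivity
      rw [hcn]; simp only [hc]; linarith)
    (fun i j hij => by
      have e : c i • (ν₀ : E3) - c j • (ν₀ : E3) =
          (((i : ℝ) - j) * (A / (4 * n))) • (ν₀ : E3) := by
        rw [← sub_smul]; congr 1; simp only [hc]; ring
      rw [dist_eq_norm, e, norm_smul, norm_eq_of_mem_sphere, mul_one, Real.norm_eq_abs, abs_mul,
        abs_of_pos (show 0 < A / (4 * n) by positivity)]
      refine le_mul_of_one_le_left (by positivity) ?_
      have h1 : ((i : ℕ) : ℤ) - ((j : ℕ) : ℤ) ≠ 0 := by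
        intro h; apply hij; ext; omega
      have h2 := Int.one_le_abs h1
      exact_mod_cast h2)
  set J := (1 - q) ^ 2 / (R - t) + 2 * (1 - q) * q / (R + A / 4) +
    q ^ 2 * (1 / (n * (r * R / 4)) + 1 / (A / (4 * n))) with hJ
  have hJ0 : 0 ≤ J := by
    have : 0 ≤ 1 - q := by linarith
    have : 0 < R - t := by linarith
    positivity
  rw [energy_eq, energy_eq]
  calc _ ≤ ENNReal.ofReal σ * ENNReal.ofReal (4 * Real.pi * R ^ 2 + C₁ * r) +
        ENNReal.ofReal (Q ^ 2 / 2) * ENNReal.ofReal (k * J) := by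
        gcongr
        exact hper r t hr hr1.le ht htA htC
    _ = ENNReal.ofReal (σ * (4 * Real.pi * R ^ 2 + C₁ * r) + Q ^ 2 / 2 * (k * J)) := by
        rw [← ENNReal.ofReal_mul hσ.le, ← ENNReal.ofReal_mul (by positivity),
          ← ENNReal.ofReal_add (by positivity) (by positivity)]
    _ < ENNReal.ofReal (σ * (4 * Real.pi * R ^ 2) + Q ^ 2 / 2 * (k * (1 / R))) := by
        rw [ENNReal.ofReal_lt_ofReal_iff (by positivity)]
        have h1 : Q ^ 2 / 2 * k * (J + K * r) < Q ^ 2 / 2 * k * (1 / R) := by gcongr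
        have h2 : Q ^ 2 / 2 * k * (K * r) = σ * C₁ * r := by
          rw [hK]; field_simp
        linarith
    _ = ENNReal.ofReal σ * ENNReal.ofReal (4 * Real.pi * R ^ 2) +
        ENNReal.ofReal (Q ^ 2 / 2) * ENNReal.ofReal (k * (1 / R)) := by
        rw [← ENNReal.ofReal_mul hσ.le, ← ENNReal.ofReal_mul (by positivity),
          ← ENNReal.ofReal_add (by positivity) (by positivity)]
    _ ≤ _ := by
        gcongr
        · exact le_perimeter_closedBall hR
        · exact le_inverseCapacitance_closedBall hε₀ hR

/-! ### Localization of the spike in a geodesic ball. -/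

theorem exists_chord_angle_lt (ν₀ : S2) {ρ : ℝ} (hρ : 0 < ρ) :
    ∃ κ, 0 < κ ∧ ∀ ν : S2, ‖(ν : E3) - ν₀‖ ≤ κ → ν ∈ sphericalCap ν₀ ρ := by
  have h0 : (ν₀ : E3) ≠ 0 := by
    rw [← norm_pos_iff, norm_eq_of_mem_sphere]; exact one_pos
  have hc : ContinuousAt (fun x : E3 => InnerProductGeometry.angle x (ν₀ : E3)) ν₀ :=
    (InnerProductGeometry.continuousAt_angle (x := ((ν₀ : E3), (ν₀ : E3))) h0 h0).comp
      (f := fun x : E3 => (x, (ν₀ : E3))) (by fun_prop)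
  have hlt : InnerProductGeometry.angle (ν₀ : E3) ν₀ < ρ := by
    rwa [InnerProductGeometry.angle_self h0]
  obtain ⟨κ, hκ, h⟩ := Metric.nhds_basis_closedBall.eventually_iff.1
    (hc.eventually (gt_mem_nhds hlt))
  exact ⟨κ, hκ, fun ν hν => h (mem_closedBall_iff_norm.2 hν)⟩

theorem exists_profile_energy_lt (ν₀ : S2) {σ ε₀ Q R δ : ℝ} (hσ : 0 < σ) (hε₀ : 0 < ε₀)
    (hQ : 0 < Q) (hR : 0 < R) (hδ : 0 < δ) (hδR : δ ≤ R) :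
    ∃ G : E3 → ℝ, ContDiff ℝ ∞ G ∧ (∀ x, |G x| ≤ δ / 2) ∧
      tsupport (fun ν : S2 => G ν) ⊆ sphericalCap ν₀ (δ / R) ∧
      volume (starSet R (fun ν => G ν)) = ENNReal.ofReal (4 / 3 * Real.pi * R ^ 3) ∧
      energy σ ε₀ Q (starSet R (fun ν => G ν)) < energy σ ε₀ Q (Metric.closedBall 0 R) := by
  obtain ⟨κ, hκ, hcap⟩ := exists_chord_angle_lt ν₀ (div_pos hδ hR)
  -- A bump of width `τ` vanishes from distance `2 * τ` on, so the dent gets width `κ / 2`. Height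
  -- `δ / 2` leaves room for the strict bounds by `δ`.
  obtain ⟨r, t, hr, hrκ, ht, htA, hvol, hE⟩ := exists_spike_energy_lt ν₀ (A := δ / 2) hσ hε₀ hQ hR
    (half_pos hδ) (by linarith) (half_pos hκ)
  refine ⟨spikeProfile ν₀ (δ / 2) r t (κ / 2), contDiff_spikeProfile,
    abs_spikeProfile_le (half_pos hδ).le ht htA, fun ν hν => hcap ν ?_, hvol, hE⟩
  have hcl : IsClosed {ν : S2 | ‖(ν : E3) - ν₀‖ ≤ κ} := isClosed_le (by fun_prop) continuous_const
  refine closure_minimal ?_ hcl hν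
  intro μ hμ
  by_contra h
  refine hμ (spikeProfile_eq_zero hr hrκ ?_)
  rw [mul_div_cancel₀ _ (two_ne_zero' ℝ)]
  exact (not_le.1 h).le

/-! ### Topology, Hausdorff distance and boundary regularity of radial graphs. -/

/-- A factor that depends only on the direction is in general discontinuous at the origin; its
boundedness is enough for the radial map. -/
theorem continuous_smul_self_of_bounded {m : E3 → ℝ} {M : ℝ} (hM : ∀ x, |m x| ≤ M)
    (hm : ∀ x, x ≠ 0 → ContinuousAt m x) : Continuous fun x => m x • x := by
  rw [continuous_iff_continuousAt]
  intro x
  rcases eq_or_ne x 0 with rfl | hx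
  · rw [ContinuousAt, smul_zero]
    refine squeeze_zero_norm (a := fun x => M * ‖x‖) (fun x => ?_) ?_
    · rw [norm_smul, Real.norm_eq_abs]
      gcongr
      exact hM x
    · have : Continuous fun x : E3 => M * ‖x‖ := by fun_prop
      simpa using this.tendsto 0
  · exact (hm x hx).smul continuousAt_id

/-- The factor by which the radial map from the ball onto `starSet R G` stretches. -/
def radialFactor (R : ℝ) (G : E3 → ℝ) (x : E3) : ℝ := 1 + G (‖x‖⁻¹ • x) / R

section

variable {R : ℝ} {G : E3 → ℝ}

/-- Constancy on rays is what makes division by the factor inverse to multiplication by it. -/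
theorem radialFactor_smul {s : ℝ} (hs : 0 < s) (x : E3) :
    radialFactor R G (s • x) = radialFactor R G x := by
  rw [radialFactor, radialFactor, norm_smul, Real.norm_eq_abs, abs_of_pos hs, mul_inv, mul_comm,
    mul_smul, inv_smul_smul₀ hs.ne']

theorem radialFactor_mem (hR : 0 < R) (hb : ∀ x, |G x| ≤ R / 2) (x : E3) :
    radialFactor R G x ∈ Icc (1 / 2 : ℝ) (3 / 2) := by
  have h := abs_le.1 (hb (‖x‖⁻¹ • x))
  have h1 : -(1 / 2) ≤ G (‖x‖⁻¹ • x) / R := by rw [le_div_iff₀ hR]; linarith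
  have h2 : G (‖x‖⁻¹ • x) / R ≤ 1 / 2 := by rw [div_le_iff₀ hR]; linarith
  rw [radialFactor]
  constructor <;> linarith

theorem radialFactor_pos (hR : 0 < R) (hb : ∀ x, |G x| ≤ R / 2) (x : E3) :
    0 < radialFactor R G x := by
  linarith [(radialFactor_mem hR hb x).1]

theorem continuousAt_radialFactor (hG : Continuous G) {x : E3} (hx : x ≠ 0) :
    ContinuousAt (radialFactor R G) x := by
  unfold radialFactor
  have h : ContinuousAt (fun x : E3 => ‖x‖⁻¹ • x) x :=
    (continuous_norm.continuousAt.inv₀ (norm_ne_zero_iff.2 hx)).smul continuousAt_id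
  exact continuousAt_const.add ((hG.continuousAt.comp h).div_const R)

/-- The radial homeomorphism of `ℝ³` taking the ball to `starSet R G`. -/
def radialHomeomorph (hR : 0 < R) (hb : ∀ x, |G x| ≤ R / 2) (hG : Continuous G) : E3 ≃ₜ E3 where
  toFun x := radialFactor R G x • x
  invFun x := (radialFactor R G x)⁻¹ • x
  left_inv x := by
    have h := radialFactor_pos hR hb x
    simp only
    rw [radialFactor_smul h, inv_smul_smul₀ h.ne']
  right_inv x := by
    have h := radialFactor_pos hR hb x
    simp only
    rw [radialFactor_smul (inv_pos.2 h), smul_inv_smul₀ h.ne']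
  continuous_toFun := by
    refine continuous_smul_self_of_bounded (M := 3 / 2) (fun x => ?_)
      fun x hx => continuousAt_radialFactor hG hx
    rw [abs_of_pos (radialFactor_pos hR hb x)]
    exact (radialFactor_mem hR hb x).2
  continuous_invFun := by
    refine continuous_smul_self_of_bounded (M := 2) (fun x => ?_)
      fun x hx => (continuousAt_radialFactor hG hx).inv₀ (radialFactor_pos hR hb x).ne'
    have h := radialFactor_pos hR hb x
    rw [abs_of_pos (inv_pos.2 h), inv_le_iff_one_le_mul₀ h]
    linarith [(radialFactor_mem hR hb x).1]

theorem radialHomeomorph_mem_starSet (hR : 0 < R) (hb : ∀ x, |G x| ≤ R / 2) (hG : Continuous G)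
    (x : E3) :
    radialHomeomorph hR hb hG x ∈ starSet R (fun ν => G ν) ↔ x ∈ Metric.closedBall 0 R := by
  have hm := radialFactor_pos hR hb x
  show radialFactor R G x • x ∈ _ ↔ _
  rcases eq_or_ne x 0 with rfl | hx
  · simp [zero_mem_starSet, hR.le]
  · rw [mem_starSet_iff (smul_ne_zero hm.ne' hx), mem_closedBall_zero_iff, radialExcess, norm_smul,
      Real.norm_eq_abs, abs_of_pos hm, mul_inv, mul_comm _ (‖x‖⁻¹), mul_smul,
      inv_smul_smul₀ hm.ne']
    have e : radialFactor R G x * R = R + G (‖x‖⁻¹ • x) := by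
      rw [radialFactor]; field_simp
    rw [sub_sub, ← e, ← mul_sub]
    constructor
    · intro h; nlinarith
    · intro h; nlinarith

theorem image_radialHomeomorph (hR : 0 < R) (hb : ∀ x, |G x| ≤ R / 2) (hG : Continuous G) :
    radialHomeomorph hR hb hG '' Metric.closedBall 0 R = starSet R (fun ν => G ν) := by
  ext y
  obtain ⟨x, rfl⟩ := (radialHomeomorph hR hb hG).surjective y
  rw [radialHomeomorph_mem_starSet]
  exact (radialHomeomorph hR hb hG).injective.mem_set_image

theorem isCompact_starSet (hR : 0 < R) (hb : ∀ x, |G x| ≤ R / 2) (hG : Continuous G) :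
    IsCompact (starSet R (fun ν => G ν)) := by
  rw [← image_radialHomeomorph hR hb hG]
  exact (isCompact_closedBall 0 R).image (radialHomeomorph hR hb hG).continuous

theorem nonempty_homeomorph_starSet (hR : 0 < R) (hb : ∀ x, |G x| ≤ R / 2) (hG : Continuous G) :
    Nonempty (starSet R (fun ν => G ν) ≃ₜ Metric.closedBall (0 : E3) R) := by
  rw [← image_radialHomeomorph hR hb hG]
  exact ⟨((radialHomeomorph hR hb hG).image _).symm⟩

/-- The radial homeomorphism matches the points of the two sets and moves each point of the ball by
at most `δ`. -/
theorem hausdorffDist_starSet_le {δ : ℝ} (hR : 0 < R) (hb : ∀ x, |G x| ≤ R / 2)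
    (hG : Continuous G) (hδ : ∀ x, |G x| ≤ δ) :
    Metric.hausdorffDist (starSet R (fun ν => G ν)) (Metric.closedBall 0 R) ≤ δ := by
  have hδ0 : 0 ≤ δ := (abs_nonneg _).trans (hδ 0)
  have key : ∀ x ∈ Metric.closedBall (0 : E3) R, dist (radialHomeomorph hR hb hG x) x ≤ δ := by
    intro x hx
    have e : radialHomeomorph hR hb hG x - x = (G (‖x‖⁻¹ • x) / R) • x := by
      show radialFactor R G x • x - x = _
      rw [radialFactor, add_smul, one_smul, add_sub_cancel_left]
    rw [mem_closedBall_zero_iff] at hx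
    rw [dist_eq_norm, e, norm_smul, Real.norm_eq_abs, abs_div, abs_of_pos hR]
    calc _ ≤ δ / R * R := by gcongr; exact hδ _
      _ = δ := by field_simp
  rw [← image_radialHomeomorph hR hb hG]
  refine Metric.hausdorffDist_le_of_mem_dist hδ0 ?_ ?_
  · rintro _ ⟨x, hx, rfl⟩
    exact ⟨x, hx, key x hx⟩
  · intro x hx
    exact ⟨_, mem_image_of_mem _ hx, by rw [dist_comm]; exact key x hx⟩

/-- Along the ray through `x` the function is affine with slope `‖x‖`, so its derivative in the
direction `x` is positive. -/
theorem fderiv_radialExcess_ne_zero {n : WithTop ℕ∞} (hn : n ≠ 0) (hG : ContDiff ℝ n G) {x : E3}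
    (hx : x ≠ 0) : fderiv ℝ (radialExcess R G) x ≠ 0 := by
  intro h0
  have hx' : 0 < ‖x‖ := norm_pos_iff.2 hx
  have h1 : HasFDerivAt (radialExcess R G) (0 : E3 →L[ℝ] ℝ) ((1 : ℝ) • x) := by
    rw [one_smul, ← h0]
    exact ((contDiffAt_radialExcess R hG hx).differentiableAt hn).hasFDerivAt
  have h2 : HasDerivAt (fun s : ℝ => s • x) ((1 : ℝ) • x) 1 := (hasDerivAt_id 1).smul_const x
  have h3 : HasDerivAt (fun s : ℝ => radialExcess R G (s • x)) 0 1 := by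
    simpa using! h1.comp_hasDerivAt 1 h2
  have h4 : HasDerivAt (fun s : ℝ => s * ‖x‖ - (R + G (‖x‖⁻¹ • x))) (1 * ‖x‖) 1 :=
    ((hasDerivAt_id 1).mul_const ‖x‖).sub_const _
  have h5 : (fun s : ℝ => radialExcess R G (s • x)) =ᶠ[𝓝 1]
      fun s : ℝ => s * ‖x‖ - (R + G (‖x‖⁻¹ • x)) := by
    filter_upwards [lt_mem_nhds (zero_lt_one' ℝ)] with s hs
    rw [radialExcess, norm_smul, Real.norm_eq_abs, abs_of_pos hs, mul_inv, mul_comm s⁻¹, mul_smul,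
      inv_smul_smul₀ hs.ne', sub_sub]
  have := h3.unique (h4.congr_of_eventuallyEq h5)
  linarith

theorem hasSmoothBoundary_starSet (hR : 0 < R) (hb : ∀ x, |G x| ≤ R / 2) (hG : ContDiff ℝ ∞ G) :
    HasSmoothBoundary (starSet R (fun ν => G ν)) := by
  intro x hx
  have hx0 : x ≠ 0 := by
    rintro rfl
    refine hx.2 (mem_interior.2 ⟨Metric.ball 0 (R / 2), fun y hy => ?_, Metric.isOpen_ball,
      Metric.mem_ball_self (half_pos hR)⟩)
    intro hy0
    have h := neg_le_of_abs_le (hb (direction y hy0))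
    rw [mem_ball_zero_iff] at hy
    linarith
  refine ⟨{0}ᶜ, radialExcess R G, isOpen_compl_singleton, hx0,
    fun y hy => (contDiffAt_radialExcess R hG hy).contDiffWithinAt,
    fderiv_radialExcess_ne_zero (by simp) hG hx0, ?_⟩
  ext y
  constructor
  · rintro ⟨h1, h2⟩; exact ⟨(mem_starSet_iff h2).1 h1, h2⟩
  · rintro ⟨h1, h2⟩; exact ⟨(mem_starSet_iff h2).2 h1, h2⟩

end

end ConductingDrop

end

/-! ### The theorem. -/

theorem theorem2 (σ ε₀ V Q R : ℝ) (hσ : 0 < σ) (hε₀ : 0 < ε₀) (hV : 0 < V) (hQ : 0 < Q)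
    (hR : 0 < R) (hVR : V = 4 / 3 * Real.pi * R ^ 3) :
    (∃ ν₀ : ConductingDrop.S2, ∃ δ₀ : ℝ, 0 < δ₀ ∧ ∀ δ : ℝ, 0 < δ → δ < δ₀ →
      ∃ φ : ConductingDrop.S2 → ℝ,
        ContMDiff (𝓡 2) 𝓘(ℝ, ℝ) ∞ φ ∧
        (∀ ν, -δ < φ ν ∧ φ ν < δ) ∧
        tsupport φ ⊆ ConductingDrop.sphericalCap ν₀ (δ / R) ∧
        volume (ConductingDrop.starSet R φ) = ENNReal.ofReal V ∧
        ConductingDrop.energy σ ε₀ Q (ConductingDrop.starSet R φ) <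
          ConductingDrop.energy σ ε₀ Q (Metric.closedBall 0 R)) ∧
    (∀ ε : ℝ, 0 < ε → ∃ Ω : Set ConductingDrop.E3,
        IsCompact Ω ∧
        ConductingDrop.HasSmoothBoundary Ω ∧
        Nonempty (Ω ≃ₜ Metric.closedBall (0 : ConductingDrop.E3) R) ∧
        volume Ω = ENNReal.ofReal V ∧
        Metric.hausdorffDist Ω (Metric.closedBall 0 R) < ε ∧
        ConductingDrop.energy σ ε₀ Q Ω <
          ConductingDrop.energy σ ε₀ Q (Metric.closedBall 0 R)) := by
  have key := fun (δ : ℝ) (hδ : 0 < δ) (hδR : δ ≤ R) =>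
    ConductingDrop.exists_profile_energy_lt ⟨EuclideanSpace.single 0 1, by simp⟩
      (σ := σ) (ε₀ := ε₀) (Q := Q) (R := R) hσ hε₀ hQ hR hδ hδR
  rw [hVR]
  constructor
  · refine ⟨⟨EuclideanSpace.single 0 1, by simp⟩, R, hR, fun δ hδ hδR => ?_⟩
    obtain ⟨G, hG, hb, hsupp, hvol, hE⟩ := key δ hδ hδR.le
    have : Fact (Module.finrank ℝ ConductingDrop.E3 = 2 + 1) := ⟨finrank_euclideanSpace_fin⟩
    refine ⟨fun ν => G ν, hG.contMDiff.comp (contMDiff_coe_sphere (n := 2)), fun ν => ?_, hsupp,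
      hvol, hE⟩
    have h := abs_le.1 (hb ν)
    constructor <;> linarith
  · intro ε hε
    obtain ⟨G, hG, hb, -, hvol, hE⟩ := key (min ε R) (lt_min hε hR) (min_le_right _ _)
    have hbR : ∀ x, |G x| ≤ R / 2 := fun x => (hb x).trans (by gcongr; exact min_le_right _ _)
    have hbε : ∀ x, |G x| ≤ ε / 2 := fun x => (hb x).trans (by gcongr; exact min_le_left _ _)
    exact ⟨ConductingDrop.starSet R (fun ν => G ν),
      ConductingDrop.isCompact_starSet hR hbR hG.continuous,
      ConductingDrop.hasSmoothBoundary_starSet hR hbR hG,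
      ConductingDrop.nonempty_homeomorph_starSet hR hbR hG.continuous, hvol,
      (ConductingDrop.hausdorffDist_starSet_le hR hbR hG.continuous hbε).trans_lt (by linarith), hE⟩
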